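/- **Setting.** For $l=1,2$ let $X_l\subset\mathbb R^{m_l}$ be nonempty, compact and convex, let $\|\cdot\|$ be a norm on $\mathbb R^{m_l}$ with dual norm $\|\cdot\|_*$, and let $\mathcal V_l=\{1,\dots,n_l\}$, $n_l\ge 1$, be the agents of subnetwork $l$. Let $\xi$ be a random vector in $\mathbb R^d$ and let $f_{l,i}(x_1,x_2)=\mathbb E[\phi_{l,i}(x_1,x_2;\xi)]$ (the expectations being finite) be continuous on $X_1\times X_2$, convex in $x_l$ and concave in $x_{3-l}$, with $$U(x_1,x_2)=\frac1{n_1}\sum_{i=1}^{n_1}f_{1,i}(x_1,x_2)=-\frac1{n_2}\sum_{j=1}^{n_2}f_{2,j}(x_1,x_2).$$ A Nash equilibrium is a point $(x_1^*,x_2^*)\in X_1\times X_2$ with $U(x_1^*,x_2)\le U(x_1^*,x_2^*)\le U(x_1,x_2^*)$ for all $(x_1,x_2)\in X_1\times X_2$. *Communication.* For some $\eta\in(0,1)$, the mixing matrices $W_l(t)=[w_{l,ij}(t)]$, $t\ge0$, are doubly stochastic with $w_{l,ij}(t)\ge\eta$ if $(j,i)\in\mathcal E_l(t)$ and $w_{l,ij}(t)=0$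 otherwise, where the digraphs $(\mathcal V_l,\mathcal E_l(t))$ contain all self-loops and are uniformly jointly strongly connected: there is $B_l\ge1$ such that for every $k\ge0$ the union of the graphs at times $k,\dots,k+B_l-1$ is strongly connected. The weights $w_{12,ij}(t)\ge0$ that an agent $i\in\mathcal V_l$ gives to the agents $j\in\mathcal V_{3-l}$ sum to $1$ and are positive only along edges of a bipartite digraph $\mathcal G_{12}(t)$. *Regularizers.* Let $\psi_l$ be continuous and $1$-strongly convex on $X_l$ and differentiable (relative to $X_l$) at the points of a set $X_l^\circ\subseteq X_l$; put $D_{\psi_l}(x,p)=\psi_l(x)-\psi_l(p)-\langle\nabla\psi_l(p),x-p\rangle$ for $x\in X_l$, $p\in X_l^\circ$, and $P^l_x(y)=\arg\min_{x'\in X_l}\{\langle y,x-x'\rangle+D_{\psi_l}(x',x)\}$ for $x\in X_l^\circ$, and suppose $P^l_x(y)\in X_l^\circ$ for all $x\in X_l^\circ$ and all $y$. (If $\psi_l$ is differentiable on $X_l$, one can take $X_l^\circ=X_l$; for the entropy on the simplex, $X_l^\circ$ is its positive part.) *Algorithm (D-SMD).* Let $\alpha(t)\ge0$ be non-increasing.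 From (possibly random) $x_{l,i}(0)\in X_l^\circ$, $$v_{l,i}(t)=\sum_{j}w_{l,ij}(t)x_{l,j}(t),\qquad u_{3-l,i}(t)=\sum_j w_{12,ij}(t)x_{3-l,j}(t),\qquad x_{l,i}(t+1)=P^l_{v_{l,i}(t)}(-\alpha(t)\hat g_{l,i}(t)),$$ where the $\xi_{l,i}(t)$ are i.i.d. copies of $\xi$, and $\hat g_{l,i}(t)$ is a subgradient of $\phi_{l,i}$ in its $l$-th variable on $X_l$ at the point with $l$-th component $v_{l,i}(t)$ and other component $u_{3-l,i}(t)$, for the sample $\xi_{l,i}(t)$. Let $\mathcal F_t$ be generated by all $x_{l,i}(0)$ and all $\xi_{l,i}(s)$, $s\le t-1$; $\hat g_{l,i}(t)$ is $\mathcal F_{t+1}$-measurable. **Assumptions.** * (A1) There is $L>0$ with $|f_{l,i}(x_1,x_2)-f_{l,i}(x_1',x_2')|\le L(\|x_1-x_1'\|+\|x_2-x_2'\|)$ on $X_1\times X_2$ for all $l,i$. * (A2) There are $\nu_l>0$ and subgradients $g_{l,i}(t)$ of $f_{l,i}$ in its $l$-th variable on $X_l$, at the same points as $\hat g_{l,i}(t)$,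 with $\|g_{l,i}(t)\|_*\le L$ (automatic at interior points of $X_l$), such that $\hat g_{l,i}(t)$ and $\|g_{l,i}(t)-\hat g_{l,i}(t)\|_*^2$ are integrable, $\mathbb E[\hat g_{l,i}(t)\mid\mathcal F_t]=g_{l,i}(t)$ and $\mathbb E[\|g_{l,i}(t)-\hat g_{l,i}(t)\|_*^2\mid\mathcal F_t]\le\nu_l^2$ almost surely. * (A3) For every $x\in X_l$, $D_{\psi_l}(x,\cdot)$ is convex on $X_l^\circ$ (in particular $X_l^\circ$ is convex), and $D_{\psi_l}(x,p_k)\to0$ whenever $p_k\in X_l^\circ$ and $p_k\to x$. **Theorem.** Let $U$ be strictly convex in $x_1\in X_1$ and strictly concave in $x_2\in X_2$, let (A1)-(A3) hold, and let $\sum_{t=1}^\infty\alpha(t)=\infty$ and $\sum_{t=1}^\infty\alpha^2(t)<\infty$. Then the game has a unique Nash equilibrium $(x_1^*,x_2^*)$, and with probability $1$ $$\lim_{t\to\infty}x_{1,i}(t)=x_1^*,\qquad\lim_{t\to\infty}x_{2,j}(t)=x_2^*\qquad\text{for all }i\in\mathcal V_1,\ j\in\mathcal V_2.$$ -/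

import Mathlib

open MeasureTheory ProbabilityTheory Filter Topology

noncomputable section

namespace DSMD

section Prox

variable {V : Type*} [NormedAddCommGroup V] [NormedSpace ℝ V]

/-- `g` is a subgradient at `x` of the function `h` considered on the set `S`. -/
def IsSubgradient (S : Set V) (h : V → ℝ) (x : V) (g : StrongDual ℝ V) : Prop :=
  ∀ y ∈ S, h x + g (y - x) ≤ h y

/-- The Bregman divergence `D_ψ(x, p) = ψ(x) - ψ(p) - ⟨∇ψ(p), x - p⟩` of a function on `X`.
For convex `X`, `x, p ∈ X`, and `ψ` differentiable at `p` relative to `X`, the last term is the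
directional derivative of `ψ` at `p` towards `x`, whatever representative of the derivative
relative to `X` is taken. -/
def bregman (X : Set V) (ψ : V → ℝ) (x p : V) : ℝ :=
  ψ x - ψ p - fderivWithin ℝ ψ X p (x - p)

/-- `p = P_x(y)`, i.e. `p` minimizes `⟨y, x - x'⟩ + D_ψ(x', x)` over `x' ∈ X`. -/
def IsProx (X : Set V) (ψ : V → ℝ) (x : V) (y : StrongDual ℝ V) (p : V) : Prop :=
  p ∈ X ∧ IsMinOn (fun x' => y (x - x') + bregman X ψ x' x) X p

/-- A `1`-strongly convex regularizer on `X`, differentiable on the set `dom`. If `ψ` is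
differentiable on all of `X`, one takes `dom = X` and then `dom_subset`, `prox_mem` and
`continuousOn` are automatic. A smaller `dom` allows for regularizers such as the entropy on the
simplex, with `dom` the positive part of the simplex. -/
structure Regularizer (X : Set V) where
  ψ : V → ℝ
  dom : Set V
  dom_subset : dom ⊆ X
  continuousOn : ContinuousOn ψ X
  strongConvexOn : StrongConvexOn X 1 ψ
  differentiable : ∀ p ∈ dom, DifferentiableWithinAt ℝ ψ X p
  prox_mem : ∀ x ∈ dom, ∀ y p, IsProx X ψ x y p → p ∈ dom

/-- The divergence is convex in its second argument, and Bregman reciprocity holds. -/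
structure Regularizer.Reciprocal {X : Set V} (R : Regularizer X) : Prop where
  convex_right : ∀ x ∈ X, ConvexOn ℝ R.dom (fun p => bregman X R.ψ x p)
  reciprocity : ∀ x ∈ X, ∀ p : ℕ → V, (∀ k, p k ∈ R.dom) → Tendsto p atTop (𝓝 x) →
    Tendsto (fun k => bregman X R.ψ x (p k)) atTop (𝓝 0)

end Prox

/-- Communication structure of the two subnetworks (indexed by `l : Fin 2`, with `n l` agents).
`W l l t` is the mixing matrix inside subnetwork `l`; for `k ≠ l`, `W l k t` holds the weights
that the agents of subnetwork `l` give to the agents of subnetwork `k`. `Adj j i` is the edge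
from `j` to `i`. -/
structure Network (n : Fin 2 → ℕ) where
  G : ∀ l, ℕ → Digraph (Fin (n l))
  G₁₂ : ℕ → Digraph (Σ l, Fin (n l))
  W : ∀ l k, ℕ → Matrix (Fin (n l)) (Fin (n k)) ℝ
  η : ℝ
  η_pos : 0 < η
  η_lt_one : η < 1
  self_loop : ∀ l t i, (G l t).Adj i i
  jointly_connected : ∀ l, ∃ B : ℕ, 1 ≤ B ∧ ∀ s : ℕ, ∀ i j : Fin (n l),
    Relation.ReflTransGen (fun a b => ∃ t, s ≤ t ∧ t < s + B ∧ (G l t).Adj a b) i j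
  bipartite : ∀ t a b, (G₁₂ t).Adj a b → a.1 ≠ b.1
  weight_ge : ∀ l t i j, (G l t).Adj j i → η ≤ W l l t i j
  weight_zero : ∀ l t i j, ¬ (G l t).Adj j i → W l l t i j = 0
  col_sum : ∀ l t j, ∑ i, W l l t i j = 1
  row_sum : ∀ l k t i, ∑ j, W l k t i j = 1
  cross_nonneg : ∀ l k t i j, k ≠ l → 0 ≤ W l k t i j
  cross_edge : ∀ l k t i j, k ≠ l → 0 < W l k t i j → (G₁₂ t).Adj ⟨k, j⟩ ⟨l, i⟩

section Game

variable {Ω : Type*} [MeasurableSpace Ω]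
  {E : Fin 2 → Type*} [∀ l, NormedAddCommGroup (E l)] [∀ l, NormedSpace ℝ (E l)]

/-- The expected cost `f(x) = 𝔼[φ(x; ξ)]` of a sampled cost `φ` at the profile `x`. -/
def expectedCost (P : Measure Ω) {d : ℕ} (ξ : Ω → Fin d → ℝ)
    (φ : (∀ k, E k) → (Fin d → ℝ) → ℝ) (x : ∀ k, E k) : ℝ :=
  ∫ ω, φ x (ξ ω) ∂P

variable (E) in
/-- A two-network stochastic zero-sum game. Player `0` is the minimizing and player `1` the
maximizing subnetwork; `φ l i` is the sampled cost of agent `i` of subnetwork `l`. -/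
structure Game (P : Measure Ω) (n : Fin 2 → ℕ) (d : ℕ) where
  X : ∀ l, Set (E l)
  ξ : Ω → Fin d → ℝ
  φ : ∀ l, Fin (n l) → (∀ k, E k) → (Fin d → ℝ) → ℝ
  agents_pos : ∀ l, 0 < n l
  nonempty : ∀ l, (X l).Nonempty
  compact : ∀ l, IsCompact (X l)
  convex : ∀ l, Convex ℝ (X l)
  measurable_ξ : Measurable ξ
  integrable : ∀ l i, ∀ x ∈ Set.univ.pi X, Integrable (fun ω => φ l i x (ξ ω)) P
  cost_continuous : ∀ l i, ContinuousOn (expectedCost P ξ (φ l i)) (Set.univ.pi X)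
  cost_convex : ∀ l i, ∀ x ∈ Set.univ.pi X,
    ConvexOn ℝ (X l) (fun y => expectedCost P ξ (φ l i) (Function.update x l y))
  cost_concave : ∀ l i, ∀ k ≠ l, ∀ x ∈ Set.univ.pi X,
    ConcaveOn ℝ (X k) (fun y => expectedCost P ξ (φ l i) (Function.update x k y))
  zero_sum : ∀ x ∈ Set.univ.pi X,
    (1 / (n 0 : ℝ)) * ∑ i, expectedCost P ξ (φ 0 i) x =
      -((1 / (n 1 : ℝ)) * ∑ j, expectedCost P ξ (φ 1 j) x)

namespace Game

variable {P : Measure Ω} {n : Fin 2 → ℕ} {d : ℕ}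

/-- The expected cost `f_{l,i}` of agent `i` of subnetwork `l`. -/
def f (Γ : Game E P n d) (l : Fin 2) (i : Fin (n l)) (x : ∀ k, E k) : ℝ :=
  expectedCost P Γ.ξ (Γ.φ l i) x

/-- The cost function of the game. -/
def U (Γ : Game E P n d) (x : ∀ k, E k) : ℝ :=
  (1 / (n 0 : ℝ)) * ∑ i, Γ.f 0 i x

/-- `U` is strictly convex in the first and strictly concave in the second variable. -/
def StrictConvexConcave (Γ : Game E P n d) : Prop :=
  ∀ x ∈ Set.univ.pi Γ.X,
    StrictConvexOn ℝ (Γ.X 0) (fun y => Γ.U (Function.update x 0 y)) ∧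
    StrictConcaveOn ℝ (Γ.X 1) (fun y => Γ.U (Function.update x 1 y))

/-- Nash equilibrium: `U(x₁*, x₂) ≤ U(x₁*, x₂*) ≤ U(x₁, x₂*)` for all `(x₁, x₂) ∈ X₁ × X₂`. -/
def IsNash (Γ : Game E P n d) (x : ∀ k, E k) : Prop :=
  x ∈ Set.univ.pi Γ.X ∧
    (∀ y ∈ Γ.X 1, Γ.U (Function.update x 1 y) ≤ Γ.U x) ∧
    (∀ y ∈ Γ.X 0, Γ.U x ≤ Γ.U (Function.update x 0 y))

/-- Every expected cost is Lipschitz continuous over `X₁ × X₂` with constant `L`. -/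
def LipschitzCosts (Γ : Game E P n d) (L : ℝ) : Prop :=
  ∀ l i, ∀ x ∈ Set.univ.pi Γ.X, ∀ x' ∈ Set.univ.pi Γ.X,
    |Γ.f l i x - Γ.f l i x'| ≤ L * (‖x 0 - x' 0‖ + ‖x 1 - x' 1‖)

end Game

/-- The weighted averages computed by agent `i` of subnetwork `l` at time `t` from the strategies
`x`: the `l`-th component is `v_{l,i}(t)`, the other one is the average `u_{3-l,i}(t)` of the
strategies in the other subnetwork. -/
def estimate {n : Fin 2 → ℕ} (N : Network n) (t : ℕ) (x : ∀ k, Fin (n k) → E k)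
    (l : Fin 2) (i : Fin (n l)) : ∀ k, E k :=
  fun k => ∑ j, N.W l k t i j • x k j

variable {P : Measure Ω} {n : Fin 2 → ℕ} {d : ℕ}

/-- A run of distributed stochastic mirror descent with step sizes `α`: samples `sample`,
strategies `x` and sampled subgradients `ghat`. `info t` is the `σ`-algebra generated by the
initial strategies and the samples up to time `t - 1`; the sampled subgradients at time `t` are
determined by the information up to time `t`. -/
structure Run [∀ l, MeasurableSpace (E l)] (Γ : Game E P n d) (N : Network n)
    (R : ∀ l, Regularizer (Γ.X l)) (α : ℕ → ℝ) where
  sample : ∀ l, Fin (n l) → ℕ → Ω → Fin d → ℝ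
  x : ∀ l, Fin (n l) → ℕ → Ω → E l
  ghat : ∀ l, Fin (n l) → ℕ → Ω → StrongDual ℝ (E l)
  info : ℕ → MeasurableSpace Ω
  info_eq : ∀ t, info t =
    (⨆ l, ⨆ i, MeasurableSpace.comap (x l i 0) inferInstance) ⊔
      ⨆ s, ⨆ (_ : s < t), ⨆ l, ⨆ i, MeasurableSpace.comap (sample l i s) inferInstance
  sample_measurable : ∀ l i t, Measurable (sample l i t)
  sample_indep : iIndepFun (fun a : (Σ l, Fin (n l)) × ℕ => sample a.1.1 a.1.2 a.2) P
  sample_ident : ∀ l i t, IdentDistrib (sample l i t) Γ.ξ P P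
  init_measurable : ∀ l i, Measurable (x l i 0)
  init_mem : ∀ l i ω, x l i 0 ω ∈ (R l).dom
  ghat_measurable : ∀ l i t, StronglyMeasurable[info (t + 1)] (ghat l i t)
  ghat_subgradient : ∀ l i t ω,
    IsSubgradient (Γ.X l)
      (fun y => Γ.φ l i
        (Function.update (estimate N t (fun k j => x k j t ω) l i) l y) (sample l i t ω))
      (estimate N t (fun k j => x k j t ω) l i l) (ghat l i t ω)
  step : ∀ l i t ω,
    IsProx (Γ.X l) (R l).ψ (estimate N t (fun k j => x k j t ω) l i l)
      (-(α t • ghat l i t ω)) (x l i (t + 1) ω)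

variable [∀ l, MeasurableSpace (E l)] {Γ : Game E P n d} {N : Network n}
  {R : ∀ l, Regularizer (Γ.X l)} {α : ℕ → ℝ}

/-- `g l i t` is a subgradient of `f_{l,i}` in the `l`-th variable at the point at which agent `i`
samples at time `t`, with dual norm at most `L`. If `f_{l,i}` is `L`-Lipschitz, the norm bound
selects exactly the subgradients of the `L`-Lipschitz extension `inf_z (f(z) + L ‖· - z‖)`
to the whole space; it is automatic at interior points of `X_l`, while at boundary points it
excludes the addition of arbitrarily large normal vectors. -/
def Run.IsCostSubgradient (r : Run Γ N R α) (L : ℝ)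
    (g : ∀ l, Fin (n l) → ℕ → Ω → StrongDual ℝ (E l)) : Prop :=
  ∀ l i t ω,
    IsSubgradient (Γ.X l)
      (fun y => Γ.f l i (Function.update (estimate N t (fun k j => r.x k j t ω) l i) l y))
      (estimate N t (fun k j => r.x k j t ω) l i l) (g l i t ω) ∧
    ‖g l i t ω‖ ≤ L

/-- The sampled subgradients are conditionally unbiased with conditional variance at most
`ν l ^ 2`. -/
structure Run.UnbiasedBounded (r : Run Γ N R α) (ν : Fin 2 → ℝ)
    (g : ∀ l, Fin (n l) → ℕ → Ω → StrongDual ℝ (E l)) : Prop where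
  integrable : ∀ l i t, Integrable (r.ghat l i t) P
  integrable_sq : ∀ l i t, Integrable (fun ω => ‖g l i t ω - r.ghat l i t ω‖ ^ 2) P
  unbiased : ∀ l i t, P[r.ghat l i t | r.info t] =ᵐ[P] g l i t
  variance : ∀ l i t,
    P[fun ω => ‖g l i t ω - r.ghat l i t ω‖ ^ 2 | r.info t] ≤ᵐ[P] fun _ => ν l ^ 2

end Game

end DSMD

end

open MeasureTheory ProbabilityTheory Filter Topology

noncomputable section

namespace DSMD

/-! ### Bregman divergences and the prox step. -/

section Bregman

variable {V : Type*} [NormedAddCommGroup V] [NormedSpace ℝ V] {X : Set V} {ψ : V → ℝ}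

/-! A saddle point exists by a minimax argument (`exists_saddle`), and strictness makes it unique.
Fix it as z and use as Lyapunov function V(t) the averaged Bregman divergence of z from the agents'
strategies (`Run.divergence`).

Mixing does not increase V, because D(z, ·) is convex and the weights are doubly stochastic. A
mirror step adds a linear term, which splits into a true subgradient part and noise, and at most
α²‖ĝ‖²/2. Replacing the sampling points by the network means costs 2Lα times the disagreements; at
the means the zero-sum structure turns the averaged cost differences into minus a duality gap. So
V(t+1) ≤ V(t) − α(t)·gap + errors + noise (`Run.divergence_succ_le`).

Almost surely α‖ĝ‖ is square summable, by the variance bound. It dominates the perturbation of a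
contracting consensus iteration, so the disagreements are square summable too
(`summable_disagreement_sq`) and their products with α are summable. The noise series converges as a
martingale with summable variances. Hence V converges and Σ α·gap < ∞ (`exists_tendsto_of_descent`).
Since Σ α = ∞, the gap tends to 0 along a subsequence; by compactness, vanishing disagreement and
strictness, all strategies tend to z along a further subsequence, where reciprocity gives V → 0. As
the whole sequence V converges, its limit is 0, and V dominates the squared distances to z. -/

/-- By convexity the segment from p to x stays in X, so the relative derivative controls this
direction whichever representative `fderivWithin` picks. The explicit sequence also serves to prove
measurability of the divergence. -/
lemma tendsto_slope_fderivWithin (hX : Convex ℝ X) {p x : V} (hp : p ∈ X) (hx : x ∈ X)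
    (hd : DifferentiableWithinAt ℝ ψ X p) :
    Tendsto (fun k : ℕ => ((k : ℝ) + 1) * (ψ (p + ((k : ℝ) + 1)⁻¹ • (x - p)) - ψ p)) atTop
      (𝓝 (fderivWithin ℝ ψ X p (x - p))) := by
  refine hd.hasFDerivWithinAt.lim (c := fun k : ℕ => (k : ℝ) + 1)
    (d := fun k : ℕ => ((k : ℝ) + 1)⁻¹ • (x - p)) ?_ ?_ ?_
  · have h : Tendsto (fun k : ℕ => ((k : ℝ) + 1)⁻¹) atTop (𝓝 0) := tendsto_inv_atTop_zero.comp
      (tendsto_atTop_add_const_right _ _ tendsto_natCast_atTop_atTop)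
    simpa using h.smul_const (x - p)
  · refine Eventually.of_forall fun k => hX.add_smul_sub_mem hp hx ⟨by positivity, ?_⟩
    exact inv_le_one_of_one_le₀ (by linarith [(k.cast_nonneg : (0 : ℝ) ≤ k)])
  · refine tendsto_const_nhds.congr fun k => ?_
    have : (k : ℝ) + 1 ≠ 0 := by positivity
    rw [smul_smul, mul_inv_cancel₀ this, one_smul]

/-- Write strong convexity at p + s(x − p), divide by s and let s → 0. -/
lemma norm_sq_le_bregman (hψ : StrongConvexOn X 1 ψ) {p x : V} (hp : p ∈ X) (hx : x ∈ X)
    (hd : DifferentiableWithinAt ℝ ψ X p) : ‖x - p‖ ^ 2 / 2 ≤ bregman X ψ x p := by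
  have h1 := tendsto_slope_fderivWithin hψ.1 hp hx hd
  have h2 : Tendsto (fun k : ℕ => ψ x - ψ p - (1 - ((k : ℝ) + 1)⁻¹) * (‖x - p‖ ^ 2 / 2)) atTop
      (𝓝 (ψ x - ψ p - (1 - 0) * (‖x - p‖ ^ 2 / 2))) := by
    refine tendsto_const_nhds.sub ((tendsto_const_nhds.sub ?_).mul_const _)
    exact tendsto_inv_atTop_zero.comp
      (tendsto_atTop_add_const_right _ _ tendsto_natCast_atTop_atTop)
  have h3 := le_of_tendsto_of_tendsto' h1 h2 fun k => ?_
  · unfold bregman; linarith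
  have hk : (0 : ℝ) < (k : ℝ) + 1 := by positivity
  set s : ℝ := ((k : ℝ) + 1)⁻¹ with hs
  have hs0 : 0 ≤ s := by positivity
  have hs1 : s ≤ 1 := inv_le_one_of_one_le₀ (by linarith [(k.cast_nonneg : (0 : ℝ) ≤ k)])
  have hks : ((k : ℝ) + 1) * s = 1 := mul_inv_cancel₀ hk.ne'
  have h4 := hψ.2 hx hp hs0 (sub_nonneg.2 hs1) (by ring)
  have h5 : s • x + (1 - s) • p = p + s • (x - p) := by
    rw [smul_sub, sub_smul, one_smul]; abel
  rw [h5] at h4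
  simp only [smul_eq_mul] at h4
  calc ((k : ℝ) + 1) * (ψ (p + s • (x - p)) - ψ p)
      ≤ ((k : ℝ) + 1) * (s * (ψ x - ψ p - (1 - s) * (‖x - p‖ ^ 2 / 2))) := by
        refine mul_le_mul_of_nonneg_left ?_ hk.le
        nlinarith
    _ = _ := by rw [← mul_assoc, hks, one_mul]

/-- First-order optimality: compare p with p + s(x − p), divide by s and let s → 0. -/
lemma IsProx.variational (hX : Convex ℝ X) {v p x : V} {y : StrongDual ℝ V}
    (hp : IsProx X ψ v y p) (hx : x ∈ X) (hd : DifferentiableWithinAt ℝ ψ X p) :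
    y (x - p) + fderivWithin ℝ ψ X v (x - p) ≤ fderivWithin ℝ ψ X p (x - p) := by
  refine ge_of_tendsto' (tendsto_slope_fderivWithin hX hp.1 hx hd) fun k => ?_
  have hk : (0 : ℝ) < (k : ℝ) + 1 := by positivity
  set s : ℝ := ((k : ℝ) + 1)⁻¹ with hs
  have hs1 : s ≤ 1 := inv_le_one_of_one_le₀ (by linarith [(k.cast_nonneg : (0 : ℝ) ≤ k)])
  have hks : ((k : ℝ) + 1) * s = 1 := mul_inv_cancel₀ hk.ne'
  have hm : p + s • (x - p) ∈ X := hX.add_smul_sub_mem hp.1 hx ⟨by positivity, hs1⟩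
  have h := isMinOn_iff.1 hp.2 _ hm
  have e1 : v - (p + s • (x - p)) = (v - p) - s • (x - p) := by abel
  have e2 : p + s • (x - p) - v = (p - v) + s • (x - p) := by abel
  simp only [bregman, e1, e2, map_sub y (v - p), map_add, map_smul, smul_eq_mul] at h
  have h2 : s * (y (x - p) + fderivWithin ℝ ψ X v (x - p)) ≤ ψ (p + s • (x - p)) - ψ p := by
    linarith
  calc _ = ((k : ℝ) + 1) * (s * (y (x - p) + fderivWithin ℝ ψ X v (x - p))) := by
        rw [← mul_assoc, hks, one_mul]
    _ ≤ _ := mul_le_mul_of_nonneg_left h2 hk.le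

/-- By the variational inequality D(x,p) ≤ D(x,v) − D(p,v) − y(x − p). The surplus y(p − v) is
absorbed by D(p,v) ≥ ‖p − v‖²/2 through Young's inequality. -/
lemma IsProx.bregman_le (hψ : StrongConvexOn X 1 ψ) {v p x : V} {y : StrongDual ℝ V}
    (hp : IsProx X ψ v y p) (hv : v ∈ X) (hx : x ∈ X) (hdp : DifferentiableWithinAt ℝ ψ X p)
    (hdv : DifferentiableWithinAt ℝ ψ X v) :
    bregman X ψ x p ≤ bregman X ψ x v - y (x - v) + ‖y‖ ^ 2 / 2 := by
  have h1 := hp.variational hψ.1 hx hdp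
  have h2 := norm_sq_le_bregman hψ hv hp.1 hdv
  have h3 : y (p - v) ≤ ‖y‖ * ‖p - v‖ := (le_abs_self _).trans (y.le_opNorm _)
  have e1 : y (x - p) = y (x - v) - y (p - v) := by rw [← map_sub]; congr 1; abel
  have e2 : fderivWithin ℝ ψ X v (x - p) =
      fderivWithin ℝ ψ X v (x - v) - fderivWithin ℝ ψ X v (p - v) := by
    rw [← map_sub]; congr 1; abel
  unfold bregman at *
  nlinarith [sq_nonneg (‖y‖ - ‖p - v‖)]

/-- Testing optimality with v itself gives ‖p − v‖² ≤ D(p,v) + D(v,p) ≤ y(p − v). -/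
lemma IsProx.norm_sub_le (hψ : StrongConvexOn X 1 ψ) {v p : V} {y : StrongDual ℝ V}
    (hp : IsProx X ψ v y p) (hv : v ∈ X) (hdp : DifferentiableWithinAt ℝ ψ X p)
    (hdv : DifferentiableWithinAt ℝ ψ X v) : ‖p - v‖ ≤ ‖y‖ := by
  have h1 := hp.variational hψ.1 hv hdp
  have h2 := norm_sq_le_bregman hψ hv hp.1 hdv
  have h3 := norm_sq_le_bregman hψ hp.1 hv hdp
  have h4 : y (p - v) ≤ ‖y‖ * ‖p - v‖ := (le_abs_self _).trans (y.le_opNorm _)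
  have e1 : v - p = -(p - v) := by abel
  rw [e1] at h1 h3
  unfold bregman at *
  rw [e1] at h3
  rw [norm_neg] at h3
  simp only [map_neg] at h1 h3
  have h5 : ‖p - v‖ ^ 2 ≤ ‖y‖ * ‖p - v‖ := by nlinarith
  by_contra! h
  nlinarith [norm_nonneg y]

lemma IsProx.unique (hψ : StrongConvexOn X 1 ψ) {v p q : V} {y : StrongDual ℝ V}
    (hp : IsProx X ψ v y p) (hq : IsProx X ψ v y q) (hdp : DifferentiableWithinAt ℝ ψ X p)
    (hdq : DifferentiableWithinAt ℝ ψ X q) : p = q := by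
  have h1 := hp.variational hψ.1 hq.1 hdp
  have h2 := hq.variational hψ.1 hp.1 hdq
  have h3 := norm_sq_le_bregman hψ hp.1 hq.1 hdp
  have h4 := norm_sq_le_bregman hψ hq.1 hp.1 hdq
  have e1 : q - p = -(p - q) := by abel
  unfold bregman at *
  rw [e1] at h1 h3
  rw [norm_neg] at h3
  simp only [map_neg] at h1 h3
  have h5 : ‖p - q‖ ^ 2 ≤ 0 := by linarith
  have h6 : ‖p - q‖ = 0 := by nlinarith [norm_nonneg (p - q)]
  exact sub_eq_zero.1 (norm_eq_zero.1 h6)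

end Bregman

/-! ### Existence of a saddle point. -/

section Saddle

/-- Minimax theorem for strictly convex functions of the first variable. -/
lemma exists_saddle {A B : Type*} [NormedAddCommGroup A] [NormedSpace ℝ A]
    [NormedAddCommGroup B] [NormedSpace ℝ B] {S : Set A} {T : Set B} {u : A → B → ℝ}
    (hS : IsCompact S) (hT : IsCompact T) (hS0 : S.Nonempty) (hT0 : T.Nonempty)
    (hu : ContinuousOn (fun z : A × B => u z.1 z.2) (S ×ˢ T))
    (hconv : ∀ b ∈ T, StrictConvexOn ℝ S (fun a => u a b))
    (hconc : ∀ a ∈ S, ConcaveOn ℝ T (fun b => u a b)) :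
    ∃ a ∈ S, ∃ b ∈ T, (∀ y ∈ T, u a y ≤ u a b) ∧ (∀ x ∈ S, u a b ≤ u x b) := by
  have hmin : ∀ b : B, ∃ a, b ∈ T → a ∈ S ∧ ∀ x ∈ S, u a b ≤ u x b := by
    intro b
    by_cases hb : b ∈ T
    · have hc : ContinuousOn (fun a => u a b) S :=
        hu.comp (f := fun a => (a, b)) (by fun_prop) fun a ha => ⟨ha, hb⟩
      obtain ⟨a, ha, h⟩ := hS.exists_isMinOn hS0 hc
      exact ⟨a, fun _ => ⟨ha, fun x hx => h hx⟩⟩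
    · exact ⟨0, fun h => (hb h).elim⟩
  choose m hm using hmin
  -- The minimizer depends continuously on b, up to subsequences: a limit of minimizers is a
  -- minimizer, and there is only one.
  have hlim : ∀ (b : ℕ → B) (b₀ : B), (∀ k, b k ∈ T) → b₀ ∈ T → Tendsto b atTop (𝓝 b₀) →
      ∃ φ : ℕ → ℕ, StrictMono φ ∧ Tendsto (fun k => m (b (φ k))) atTop (𝓝 (m b₀)) := by
    intro b b₀ hb hb₀ hbt
    obtain ⟨a, ha, φ, hφ, ht⟩ := hS.tendsto_subseq (x := fun k => m (b k)) fun k => (hm _ (hb k)).1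
    have hbt' := hbt.comp hφ.tendsto_atTop
    have hle : ∀ x ∈ S, u a b₀ ≤ u x b₀ := by
      intro x hx
      have l1 : Tendsto (fun k => u (m (b (φ k))) (b (φ k))) atTop (𝓝 (u a b₀)) :=
        (hu (a, b₀) ⟨ha, hb₀⟩).tendsto.comp (tendsto_nhdsWithin_iff.2
          ⟨ht.prodMk_nhds hbt', Eventually.of_forall fun k => ⟨(hm _ (hb _)).1, hb _⟩⟩)
      have l2 : Tendsto (fun k => u x (b (φ k))) atTop (𝓝 (u x b₀)) :=
        (hu (x, b₀) ⟨hx, hb₀⟩).tendsto.comp (tendsto_nhdsWithin_iff.2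
          ⟨tendsto_const_nhds.prodMk_nhds hbt', Eventually.of_forall fun k => ⟨hx, hb _⟩⟩)
      exact le_of_tendsto_of_tendsto' l1 l2 fun k => (hm _ (hb _)).2 x hx
    have : a = m b₀ := (hconv b₀ hb₀).eq_of_isMinOn (fun x hx => hle x hx)
      (fun x hx => (hm b₀ hb₀).2 x hx) ha (hm b₀ hb₀).1
    exact ⟨φ, hφ, this ▸ ht⟩
  have hcont : ContinuousOn (fun b => u (m b) b) T := by
    intro b₀ hb₀
    refine tendsto_of_subseq_tendsto fun b hb => ?_
    obtain ⟨hb1, hb2⟩ := tendsto_nhdsWithin_iff.1 hb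
    obtain ⟨N, hN⟩ := eventually_atTop.1 hb2
    have hbN : Tendsto (fun k => b (k + N)) atTop (𝓝 b₀) := hb1.comp (tendsto_add_atTop_nat N)
    obtain ⟨φ, hφ, ht⟩ := hlim (fun k => b (k + N)) b₀ (fun k => hN _ (by omega)) hb₀ hbN
    refine ⟨fun k => φ k + N, ?_⟩
    exact (hu (m b₀, b₀) ⟨(hm _ hb₀).1, hb₀⟩).tendsto.comp (tendsto_nhdsWithin_iff.2
      ⟨ht.prodMk_nhds (hbN.comp hφ.tendsto_atTop), Eventually.of_forall fun k =>
        ⟨(hm _ (hN _ (by omega))).1, hN _ (by omega)⟩⟩)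
  -- The saddle point is (m b, b) with b maximizing the value function min over a of u(a, b). To
  -- test it against y, b is moved slightly towards y.
  obtain ⟨b, hb, hmax⟩ := hT.exists_isMaxOn hT0 hcont
  refine ⟨m b, (hm b hb).1, b, hb, fun y hy => ?_, (hm b hb).2⟩
  have hT' : Convex ℝ T := (hconc _ (hm b hb).1).1
  set s : ℕ → ℝ := fun k => ((k : ℝ) + 1)⁻¹
  have hs0 : ∀ k, 0 < s k := fun k => by positivity
  have hs1 : ∀ k, s k ≤ 1 := fun k =>
    inv_le_one_of_one_le₀ (by linarith [(k.cast_nonneg : (0 : ℝ) ≤ k)])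
  have hst : Tendsto s atTop (𝓝 0) := tendsto_inv_atTop_zero.comp
    (tendsto_atTop_add_const_right _ _ tendsto_natCast_atTop_atTop)
  set c : ℕ → B := fun k => (1 - s k) • b + s k • y
  have hcT : ∀ k, c k ∈ T := fun k =>
    hT' hb hy (sub_nonneg.2 (hs1 k)) (hs0 k).le (by ring)
  have hct : Tendsto c atTop (𝓝 b) := by
    have := ((tendsto_const_nhds (x := (1 : ℝ))).sub hst).smul_const b |>.add (hst.smul_const y)
    simpa using this
  obtain ⟨φ, hφ, ht⟩ := hlim c b hcT hb hct
  have l2 : Tendsto (fun k => u (m (c (φ k))) y) atTop (𝓝 (u (m b) y)) :=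
    (hu (m b, y) ⟨(hm _ hb).1, hy⟩).tendsto.comp (tendsto_nhdsWithin_iff.2
      ⟨ht.prodMk_nhds tendsto_const_nhds, Eventually.of_forall fun k => ⟨(hm _ (hcT _)).1, hy⟩⟩)
  -- With c = (1 − s)b + sy, concavity gives (1 − s)u(m c, b) + s u(m c, y) ≤ u(m c, c) ≤ u(m b, b),
  -- while u(m b, b) ≤ u(m c, b). Cancel and divide by s.
  refine le_of_tendsto' l2 fun k => ?_
  have h1 : u (m (c (φ k))) (c (φ k)) ≤ u (m b) b := hmax (hcT _)
  have h2 := (hconc _ (hm _ (hcT (φ k))).1).2 hb hy (sub_nonneg.2 (hs1 (φ k))) (hs0 (φ k)).le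
    (by ring)
  have h3 := (hm b hb).2 _ (hm _ (hcT (φ k))).1
  simp only [smul_eq_mul] at h2
  have h4 : (1 - s (φ k)) * u (m b) b ≤ (1 - s (φ k)) * u (m (c (φ k))) b :=
    mul_le_mul_of_nonneg_left h3 (sub_nonneg.2 (hs1 _))
  have h5 : s (φ k) * u (m (c (φ k))) y ≤ s (φ k) * u (m b) b := by
    have : c (φ k) = (1 - s (φ k)) • b + s (φ k) • y := rfl
    rw [← this] at h2
    linarith
  exact le_of_mul_le_mul_left h5 (hs0 _)

end Saddle

/-! ### Diameter of a family and its contraction under averaging. -/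

section Disagreement

variable {ι V : Type*} [NormedAddCommGroup V]

/-- The diameter of a finite family of vectors. -/
def disagreement (x : ι → V) : ℝ := ⨆ p : ι × ι, ‖x p.1 - x p.2‖

lemma norm_sub_le_disagreement [Finite ι] (x : ι → V) (i j : ι) : ‖x i - x j‖ ≤ disagreement x :=
  le_ciSup (f := fun p : ι × ι => ‖x p.1 - x p.2‖) (Set.finite_range _).bddAbove (i, j)

lemma disagreement_nonneg (x : ι → V) : 0 ≤ disagreement x :=
  Real.iSup_nonneg fun _ => norm_nonneg _

/-- Dobrushin contraction: the common mass ε at each index cancels, and the remainders, of equal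
mass m, are compared pair by pair. The case ε = 0 bounds the distance between any two averages. -/
lemma norm_sum_sub_sum_le [Fintype ι] [NormedSpace ℝ V] (x : ι → V) {p q : ι → ℝ} {ε : ℝ} (hp : ∀ j, ε ≤ p j)
    (hq : ∀ j, ε ≤ q j) (hp1 : ∑ j, p j = 1) (hq1 : ∑ j, q j = 1) :
    ‖∑ j, p j • x j - ∑ j, q j • x j‖ ≤ (1 - Fintype.card ι * ε) * disagreement x := by
  set m : ℝ := 1 - Fintype.card ι * ε
  set a : ι → ℝ := fun j => p j - ε
  set b : ι → ℝ := fun j => q j - ε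
  have ha : ∀ j, 0 ≤ a j := fun j => sub_nonneg.2 (hp j)
  have hb : ∀ j, 0 ≤ b j := fun j => sub_nonneg.2 (hq j)
  have ha1 : ∑ j, a j = m := by simp [a, m, hp1]
  have hb1 : ∑ j, b j = m := by simp [b, m, hq1]
  have hm : 0 ≤ m := ha1 ▸ Finset.sum_nonneg fun j _ => ha j
  have e1 : ∑ j, p j • x j - ∑ j, q j • x j = ∑ j, a j • x j - ∑ j, b j • x j := by
    simp [a, b, sub_smul, Finset.sum_sub_distrib]
  rw [e1]
  -- If m = 0 the remainders vanish; otherwise scaling by m lets the difference be written over the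
  -- product of the remainders.
  rcases hm.eq_or_lt with h0 | h0
  · have ha0 : ∀ j, a j = 0 := fun j => (Finset.sum_eq_zero_iff_of_nonneg fun j _ => ha j).1
      (ha1.trans h0.symm) j (Finset.mem_univ j)
    have hb0 : ∀ j, b j = 0 := fun j => (Finset.sum_eq_zero_iff_of_nonneg fun j _ => hb j).1
      (hb1.trans h0.symm) j (Finset.mem_univ j)
    simp [ha0, hb0, ← h0]
  · have e2 : m • (∑ j, a j • x j - ∑ j, b j • x j) =
        ∑ j, ∑ k, (a j * b k) • (x j - x k) := by
      simp_rw [smul_sub, Finset.sum_sub_distrib]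
      congr 1
      · rw [Finset.smul_sum]
        refine Finset.sum_congr rfl fun j _ => ?_
        rw [← Finset.sum_smul, ← Finset.mul_sum, hb1, smul_smul, mul_comm]
      · rw [Finset.sum_comm, Finset.smul_sum]
        refine Finset.sum_congr rfl fun j _ => ?_
        rw [← Finset.sum_smul, ← Finset.sum_mul, ha1, smul_smul]
    have h1 : ‖m • (∑ j, a j • x j - ∑ j, b j • x j)‖ ≤ m * (m * disagreement x) := by
      rw [e2]
      calc _ ≤ ∑ j, ∑ k, a j * b k * disagreement x := by
            refine norm_sum_le_of_le _ fun j _ => norm_sum_le_of_le _ fun k _ => ?_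
            rw [norm_smul, Real.norm_of_nonneg (mul_nonneg (ha j) (hb k))]
            exact mul_le_mul_of_nonneg_left (norm_sub_le_disagreement x j k)
              (mul_nonneg (ha j) (hb k))
        _ = _ := by
            simp_rw [← Finset.sum_mul, ← Finset.mul_sum, hb1, ← Finset.sum_mul, ha1]
            ring
    rw [norm_smul, Real.norm_of_nonneg hm] at h1
    exact le_of_mul_le_mul_left h1 h0

end Disagreement

/-! ### Perturbed consensus over jointly connected graphs. -/

section Consensus

variable {ι : Type*} [Fintype ι] [DecidableEq ι]

/-- The product `W (s + k - 1) ⋯ W s`. -/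
def transition (W : ℕ → Matrix ι ι ℝ) (s : ℕ) : ℕ → Matrix ι ι ℝ
  | 0 => 1
  | k + 1 => W (s + k) * transition W s k

variable {W : ℕ → Matrix ι ι ℝ}

lemma transition_nonneg (hW : ∀ t i j, 0 ≤ W t i j) (s k : ℕ) (i j : ι) :
    0 ≤ transition W s k i j := by
  induction k generalizing i with
  | zero => by_cases h : i = j <;> simp [transition, Matrix.one_apply, h]
  | succ k ih =>
    rw [transition, Matrix.mul_apply]
    exact Finset.sum_nonneg fun m _ => mul_nonneg (hW _ _ _) (ih m)

lemma transition_row_sum (hrow : ∀ t i, ∑ j, W t i j = 1) (s k : ℕ) (i : ι) :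
    ∑ j, transition W s k i j = 1 := by
  induction k generalizing i with
  | zero => simp [transition, Matrix.one_apply]
  | succ k ih =>
    simp_rw [transition, Matrix.mul_apply]
    rw [Finset.sum_comm]
    simp_rw [← Finset.mul_sum, ih, mul_one, hrow]

lemma exists_edge_leaving {β : Type*} {r : β → β → Prop} {S : Set β} {x y : β}
    (h : Relation.ReflTransGen r x y) (hx : x ∈ S) (hy : y ∉ S) :
    ∃ a ∈ S, ∃ b ∉ S, r a b := by
  induction h with
  | refl => exact (hy hx).elim
  | @tail b c _ hbc ih =>
    by_cases hb : b ∈ S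
    · exact ⟨b, hb, c, hy, hbc⟩
    · exact ih hb

/-- Under uniform joint strong connectivity the transition matrices over long windows have
uniformly positive entries. -/
lemma exists_transition_ge {G : ℕ → ι → ι → Prop} {η : ℝ} (hη : 0 < η)
    (hW : ∀ t i j, 0 ≤ W t i j) (hG : ∀ t i j, G t j i → η ≤ W t i j) (hself : ∀ t i, G t i i)
    {B : ℕ} (hB : ∀ s : ℕ, ∀ i j : ι,
      Relation.ReflTransGen (fun a b => ∃ t, s ≤ t ∧ t < s + B ∧ G t a b) i j) :
    ∃ T : ℕ, ∀ s i j, η ^ T ≤ transition W s T i j := by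
  refine ⟨Fintype.card ι * B, fun s i j => ?_⟩
  -- The indices that mass started at j has reached after k steps with weight at least η^k.
  -- Self-loops keep `R` monotone, and each window of length B adds an index until all are reached.
  set R : ℕ → Finset ι := fun k => Finset.univ.filter fun i => η ^ k ≤ transition W s k i j
  have hedge : ∀ k a b, G (s + k) a b → a ∈ R k → b ∈ R (k + 1) := by
    intro k a b hab ha
    simp only [R, Finset.mem_filter, Finset.mem_univ, true_and] at ha ⊢
    rw [transition, Matrix.mul_apply]
    calc η ^ (k + 1) = η * η ^ k := pow_succ' _ _
      _ ≤ W (s + k) b a * transition W s k a j :=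
        mul_le_mul (hG _ _ _ hab) ha (by positivity) (hW _ _ _)
      _ ≤ _ := Finset.single_le_sum
        (f := fun m => W (s + k) b m * transition W s k m j)
        (fun m _ => mul_nonneg (hW _ _ _) (transition_nonneg hW _ _ _ _)) (Finset.mem_univ a)
  have hmono : Monotone R := monotone_nat_of_le_succ fun k a ha => hedge k a a (hself _ a) ha
  have hj : ∀ k, j ∈ R k := fun k => hmono (Nat.zero_le k) (by simp [R, transition])
  have hcard : ∀ m : ℕ, min (m + 1) (Fintype.card ι) ≤ (R (m * B)).card := by
    intro m
    induction m with
    | zero => exact (min_le_left _ _).trans (Finset.card_pos.2 ⟨j, hj _⟩)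
    | succ m ih =>
      have hsub : R (m * B) ⊆ R ((m + 1) * B) := hmono (Nat.mul_le_mul_right _ (Nat.le_succ m))
      by_cases hall : R (m * B) = Finset.univ
      · rw [hall, Finset.univ_subset_iff] at hsub
        rw [hsub]
        exact min_le_right _ _
      · obtain ⟨c, hc⟩ : ∃ c, c ∉ R (m * B) := by
          by_contra! h
          exact hall (Finset.eq_univ_iff_forall.2 h)
        obtain ⟨a, ha, b, hb, t, ht1, ht2, hab⟩ :=
          exists_edge_leaving (S := (R (m * B) : Set ι)) (hB (s + m * B) j c) (hj _) hc
        obtain ⟨k, rfl⟩ := Nat.exists_eq_add_of_le ht1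
        have hab' : G (s + (m * B + k)) a b := by rwa [← add_assoc]
        have hbR : b ∈ R ((m + 1) * B) := by
          refine hmono ?_ (hedge _ a b hab' (hmono (Nat.le_add_right _ _) ha))
          rw [add_mul, one_mul]
          omega
        have h1 : (insert b (R (m * B))).card ≤ (R ((m + 1) * B)).card :=
          Finset.card_le_card (Finset.insert_subset hbR hsub)
        rw [Finset.card_insert_of_notMem hb] at h1
        omega
  have hfull : R (Fintype.card ι * B) = Finset.univ := by
    refine Finset.eq_univ_of_card _ (le_antisymm (Finset.card_le_univ _) ?_)
    simpa using hcard (Fintype.card ι)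
  have : i ∈ R (Fintype.card ι * B) := hfull ▸ Finset.mem_univ i
  simpa [R] using this

variable {V : Type*} [NormedAddCommGroup V] [NormedSpace ℝ V]

/-- Averaging by stochastic matrices does not enlarge the maximal error, so perturbations only add
up. -/
lemma norm_sub_transition_le (hW : ∀ t i j, 0 ≤ W t i j) (hrow : ∀ t i, ∑ j, W t i j = 1)
    {x e : ℕ → ι → V} (hx : ∀ t i, x (t + 1) i = ∑ j, W t i j • x t j + e t i) (s k : ℕ) (i : ι) :
    ‖x (s + k) i - ∑ j, transition W s k i j • x s j‖ ≤
      ∑ τ ∈ Finset.range k, ∑ i, ‖e (s + τ) i‖ := by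
  induction k generalizing i with
  | zero => simp [transition, Matrix.one_apply]
  | succ k ih =>
    have e1 : x (s + (k + 1)) i - ∑ j, transition W s (k + 1) i j • x s j =
        ∑ m, W (s + k) i m • (x (s + k) m - ∑ j, transition W s k m j • x s j) + e (s + k) i := by
      rw [← add_assoc, hx]
      simp_rw [transition, Matrix.mul_apply, smul_sub, Finset.sum_sub_distrib, Finset.smul_sum,
        Finset.sum_smul, smul_smul]
      rw [Finset.sum_comm (γ := ι)]
      abel
    rw [e1, Finset.sum_range_succ]
    refine (norm_add_le _ _).trans (add_le_add ?_ ?_)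
    · calc _ ≤ ∑ m, W (s + k) i m * ∑ τ ∈ Finset.range k, ∑ i, ‖e (s + τ) i‖ := by
            refine norm_sum_le_of_le _ fun m _ => ?_
            rw [norm_smul, Real.norm_of_nonneg (hW _ _ _)]
            exact mul_le_mul_of_nonneg_left (ih m) (hW _ _ _)
        _ = _ := by rw [← Finset.sum_mul, hrow, one_mul]
    · exact Finset.single_le_sum (f := fun i => ‖e (s + k) i‖) (fun _ _ => norm_nonneg _)
        (Finset.mem_univ i)

/-- Sum the recursion over t < M and absorb ρ Σ a into the left side; the shift by T costs only the
first T terms. -/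
lemma summable_of_delayed_contraction {a b : ℕ → ℝ} {ρ : ℝ} {T : ℕ} (ha : ∀ t, 0 ≤ a t)
    (hb : ∀ t, 0 ≤ b t) (hρ1 : ρ < 1) (hbs : Summable b)
    (h : ∀ t, a (t + T) ≤ ρ * a t + b t) : Summable a := by
  refine summable_of_sum_range_le (c := (∑ t ∈ Finset.range T, a t + ∑' t, b t) / (1 - ρ)) ha
    fun M => ?_
  rw [le_div_iff₀ (sub_pos.2 hρ1)]
  have h1 : ∑ t ∈ Finset.range M, a t ≤ ∑ t ∈ Finset.range (M + T), a t :=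
    Finset.sum_le_sum_of_subset_of_nonneg (Finset.range_mono (Nat.le_add_right _ _))
      fun t _ _ => ha t
  have h2 : ∑ t ∈ Finset.range (M + T), a t =
      ∑ t ∈ Finset.range T, a t + ∑ t ∈ Finset.range M, a (t + T) := by
    rw [add_comm M T, Finset.sum_range_add]
    simp_rw [add_comm T]
  have h3 : ∑ t ∈ Finset.range M, a (t + T) ≤
      ρ * ∑ t ∈ Finset.range M, a t + ∑ t ∈ Finset.range M, b t := by
    rw [Finset.mul_sum, ← Finset.sum_add_distrib]
    exact Finset.sum_le_sum fun t _ => h t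
  have h4 : ∑ t ∈ Finset.range M, b t ≤ ∑' t, b t := hbs.sum_le_tsum _ fun t _ => hb t
  linarith

/-- Perturbed consensus: the disagreement is square summable when the perturbations are. -/
theorem summable_disagreement_sq [Nonempty ι] {G : ℕ → ι → ι → Prop} {η : ℝ} (hη : 0 < η)
    (hW : ∀ t i j, 0 ≤ W t i j) (hrow : ∀ t i, ∑ j, W t i j = 1)
    (hG : ∀ t i j, G t j i → η ≤ W t i j) (hself : ∀ t i, G t i i)
    {B : ℕ} (hB : ∀ s : ℕ, ∀ i j : ι,
      Relation.ReflTransGen (fun a b => ∃ t, s ≤ t ∧ t < s + B ∧ G t a b) i j)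
    {x e : ℕ → ι → V} (hx : ∀ t i, x (t + 1) i = ∑ j, W t i j • x t j + e t i)
    (he : ∀ i, Summable fun t => ‖e t i‖ ^ 2) :
    Summable fun t => disagreement (x t) ^ 2 := by
  obtain ⟨T, hT⟩ := exists_transition_ge hη hW hG hself hB
  set D : ℕ → ℝ := fun t => disagreement (x t)
  set b : ℕ → ℝ := fun t => 2 * ∑ τ ∈ Finset.range T, ∑ i, ‖e (t + τ) i‖
  set ρ : ℝ := 1 - Fintype.card ι * η ^ T
  have hD : ∀ t, 0 ≤ D t := fun t => disagreement_nonneg _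
  have hρ1 : ρ < 1 := by
    have : (0 : ℝ) < Fintype.card ι := by exact_mod_cast Fintype.card_pos
    have : 0 < Fintype.card ι * η ^ T := by positivity
    simp only [ρ]; linarith
  have hρ0 : 0 ≤ ρ := by
    obtain ⟨i⟩ := ‹Nonempty ι›
    have := Finset.sum_le_sum fun j (_ : j ∈ Finset.univ) => hT 0 i j
    rw [transition_row_sum hrow] at this
    simp at this
    simp only [ρ]; linarith
  have hrec : ∀ t, D (t + T) ≤ ρ * D t + b t := by
    intro t
    refine ciSup_le fun p => ?_
    have h1 := norm_sub_transition_le hW hrow hx t T p.1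
    have h2 := norm_sub_transition_le hW hrow hx t T p.2
    have h3 := norm_sum_sub_sum_le (x t) (hT t p.1) (hT t p.2) (transition_row_sum hrow t T p.1)
      (transition_row_sum hrow t T p.2)
    have e1 : x (t + T) p.1 - x (t + T) p.2 =
        (∑ j, transition W t T p.1 j • x t j - ∑ j, transition W t T p.2 j • x t j) +
        ((x (t + T) p.1 - ∑ j, transition W t T p.1 j • x t j) -
          (x (t + T) p.2 - ∑ j, transition W t T p.2 j • x t j)) := by abel
    rw [e1]
    refine (norm_add_le _ _).trans (add_le_add h3 ((norm_sub_le _ _).trans ?_))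
    simp only [b]; linarith
  -- Cauchy-Schwarz twice, over the window and over the agents.
  have hbs : Summable fun t => b t ^ 2 := by
    have hs : Summable fun t => 4 * (T * ∑ τ ∈ Finset.range T,
        (Fintype.card ι * ∑ i, ‖e (t + τ) i‖ ^ 2)) := by
      refine ((summable_sum fun τ _ => (summable_sum fun i _ => ?_).mul_left _).mul_left _).mul_left _
      exact (summable_nat_add_iff τ).2 (he i)
    refine hs.of_nonneg_of_le (fun t => sq_nonneg _) fun t => ?_
    simp only [b, mul_pow]
    norm_num
    refine (sq_sum_le_card_mul_sum_sq (s := Finset.range T)).trans ?_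
    rw [Finset.card_range]
    refine mul_le_mul_of_nonneg_left (Finset.sum_le_sum fun τ _ => ?_) (Nat.cast_nonneg _)
    simpa using sq_sum_le_card_mul_sum_sq (s := Finset.univ) (f := fun i => ‖e (t + τ) i‖)
  refine summable_of_delayed_contraction (T := T) (ρ := ρ) (b := fun t => b t ^ 2 / (1 - ρ))
    (fun t => sq_nonneg _) (fun t => div_nonneg (sq_nonneg _) (sub_pos.2 hρ1).le) hρ1
    (hbs.div_const _) fun t => ?_
  have h1 : D (t + T) ^ 2 ≤ (ρ * D t + b t) ^ 2 := pow_le_pow_left₀ (hD _) (hrec t) 2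
  have h2 : (ρ * D t + b t) ^ 2 ≤ ρ * D t ^ 2 + b t ^ 2 / (1 - ρ) := by
    have h3 : 0 < 1 - ρ := sub_pos.2 hρ1
    -- Convexity of the square with weights ρ and 1 − ρ, applied to D and b/(1 − ρ).
    have h4 : ρ * D t ^ 2 + b t ^ 2 / (1 - ρ) - (ρ * D t + b t) ^ 2 =
        ρ / (1 - ρ) * ((1 - ρ) * D t - b t) ^ 2 := by
      field_simp
      ring
    have h5 : 0 ≤ ρ / (1 - ρ) * ((1 - ρ) * D t - b t) ^ 2 := by positivity
    linarith
  exact h1.trans h2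

end Consensus

/-! ### Measurability of divergences and prox points. -/

section Measurability

lemma measurable_comp_of_continuousOn {Ω : Type*} {_ : MeasurableSpace Ω} {V : Type*}
    [TopologicalSpace V] [MeasurableSpace V] [BorelSpace V] {X : Set V} {ψ : V → ℝ} (hψ : ContinuousOn ψ X) {u : Ω → V}
    (hu : Measurable u) (hmem : ∀ ω, u ω ∈ X) : Measurable fun ω => ψ (u ω) :=
  (continuousOn_iff_continuous_domRestrict.1 hψ).measurable.comp (hu.subtype_mk (h := hmem))

variable {Ω : Type*} {_ : MeasurableSpace Ω} {V : Type*} [NormedAddCommGroup V] [NormedSpace ℝ V]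
  [FiniteDimensional ℝ V] [MeasurableSpace V] [BorelSpace V] {X : Set V}

/-- For closed C, the unique minimizer lies in C exactly when the minimum over X ∩ C does not exceed
that over X. Countable dense subsets make this a countable condition. -/
lemma measurable_of_isMinOn_unique (hX : IsCompact X) {F : Ω → V → ℝ}
    (hF : ∀ ω, ContinuousOn (F ω) X) (hm : ∀ x ∈ X, Measurable fun ω => F ω x) {p : Ω → V}
    (hpX : ∀ ω, p ω ∈ X) (hp : ∀ ω, IsMinOn (F ω) X (p ω))
    (huniq : ∀ ω, ∀ x ∈ X, IsMinOn (F ω) X x → x = p ω) : Measurable p := by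
  refine measurable_of_isClosed fun C hC => ?_
  rcases (X ∩ C).eq_empty_or_nonempty with h0 | h0
  · have : p ⁻¹' C = ∅ := Set.eq_empty_iff_forall_notMem.2 fun ω hω =>
      Set.eq_empty_iff_forall_notMem.1 h0 (p ω) ⟨hpX ω, hω⟩
    rw [this]; exact MeasurableSet.empty
  have hK : IsCompact (X ∩ C) := hX.inter_right hC
  have : Nonempty ↥(X ∩ C) := h0.to_subtype
  have : Nonempty X := (h0.mono Set.inter_subset_left).to_subtype
  set d : ℕ → ↥(X ∩ C) := TopologicalSpace.denseSeq _
  set q : ℕ → X := TopologicalSpace.denseSeq _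
  have hd : DenseRange d := TopologicalSpace.denseRange_denseSeq _
  have hq : DenseRange q := TopologicalSpace.denseRange_denseSeq _
  have hset : p ⁻¹' C = ⋂ j : ℕ, ⋂ k : ℕ, ⋃ i : ℕ,
      {ω | F ω (d i) < F ω (q j) + ((k : ℝ) + 1)⁻¹} := by
    ext ω
    simp only [Set.mem_preimage, Set.mem_iInter, Set.mem_iUnion, Set.mem_ofPred_eq]
    have hcK : Continuous fun x : ↥(X ∩ C) => F ω x :=
      continuousOn_iff_continuous_domRestrict.1 ((hF ω).mono Set.inter_subset_left)
    have hcX : Continuous fun x : X => F ω x := continuousOn_iff_continuous_domRestrict.1 (hF ω)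
    constructor
    · intro hω j k
      obtain ⟨i, hi⟩ := hd.exists_mem_open
        (isOpen_lt hcK (continuous_const (y := F ω (q j) + ((k : ℝ) + 1)⁻¹)))
        ⟨⟨p ω, hpX ω, hω⟩, by
          have h1 : F ω (p ω) ≤ F ω (q j) := hp ω (q j).2
          have h2 : (0 : ℝ) < ((k : ℝ) + 1)⁻¹ := by positivity
          simp only [Set.mem_ofPred_eq]; linarith⟩
      exact ⟨i, hi⟩
    · intro h
      obtain ⟨x₀, hx₀, hmin⟩ := hK.exists_isMinOn h0 ((hF ω).mono Set.inter_subset_left)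
      have h1 : ∀ j, F ω x₀ ≤ F ω (q j) := by
        intro j
        refine le_of_forall_pos_lt_add fun ε hε => ?_
        obtain ⟨k, hk⟩ := exists_nat_one_div_lt hε
        obtain ⟨i, hi⟩ := h j k
        have h2 : F ω x₀ ≤ F ω (d i) := hmin (d i).2
        rw [one_div] at hk
        linarith
      have h2 : ∀ x : X, F ω x₀ ≤ F ω x :=
        fun x => isClosed_property hq (isClosed_le continuous_const hcX) h1 x
      rw [← huniq ω x₀ hx₀.1 fun x hx => h2 ⟨x, hx⟩]
      exact hx₀.2
  rw [hset]
  exact MeasurableSet.iInter fun j => MeasurableSet.iInter fun k => MeasurableSet.iUnion fun i =>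
    measurableSet_lt (hm _ (d i).2.1) ((hm _ (q j).2).add_const _)

lemma Regularizer.measurable_bregman (R : Regularizer X) {v : Ω → V} (hv : Measurable v)
    (hvd : ∀ ω, v ω ∈ R.dom) {x : V} (hx : x ∈ X) :
    Measurable fun ω => bregman X R.ψ x (v ω) := by
  have hvX : ∀ ω, v ω ∈ X := fun ω => R.dom_subset (hvd ω)
  have hψv := measurable_comp_of_continuousOn R.continuousOn hv hvX
  refine (measurable_const.sub hψv).sub ?_
  refine measurable_of_tendsto_metrizable (f := fun (k : ℕ) ω =>
    ((k : ℝ) + 1) * (R.ψ (v ω + ((k : ℝ) + 1)⁻¹ • (x - v ω)) - R.ψ (v ω))) (fun k => ?_) ?_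
  · refine ((measurable_comp_of_continuousOn R.continuousOn ?_ fun ω => ?_).sub hψv).const_mul _
    · exact hv.add ((measurable_const.sub hv).const_smul _)
    · refine R.strongConvexOn.1.add_smul_sub_mem (hvX ω) hx ⟨by positivity, ?_⟩
      exact inv_le_one_of_one_le₀ (by linarith [(k.cast_nonneg : (0 : ℝ) ≤ k)])
  · exact tendsto_pi_nhds.2 fun ω =>
      tendsto_slope_fderivWithin R.strongConvexOn.1 (hvX ω) hx (R.differentiable _ (hvd ω))

lemma Regularizer.measurable_prox (R : Regularizer X) (hX : IsCompact X) {v p : Ω → V}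
    {y : Ω → StrongDual ℝ V} (hv : Measurable v) (hvd : ∀ ω, v ω ∈ R.dom)
    (hy : StronglyMeasurable y) (hp : ∀ ω, IsProx X R.ψ (v ω) (y ω) (p ω)) : Measurable p := by
  refine measurable_of_isMinOn_unique hX (F := fun ω x' => y ω (v ω - x') + bregman X R.ψ x' (v ω))
    (fun ω => ?_) (fun x hx => ?_) (fun ω => (hp ω).1) (fun ω => (hp ω).2) fun ω x hx hmin => ?_
  · unfold bregman
    exact ContinuousOn.add (by fun_prop) ((R.continuousOn.sub continuousOn_const).sub (by fun_prop))
  · refine Measurable.add ?_ (R.measurable_bregman hv hvd hx)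
    have hc : Continuous fun z : StrongDual ℝ V × V => z.1 z.2 := by fun_prop
    exact (hc.comp_stronglyMeasurable
      (hy.prodMk (hv.sub measurable_const).stronglyMeasurable)).measurable
  · have hq : IsProx X R.ψ (v ω) (y ω) x := ⟨hx, hmin⟩
    exact hq.unique R.strongConvexOn (hp ω)
      (R.differentiable _ (R.prox_mem _ (hvd ω) _ _ hq))
      (R.differentiable _ (R.prox_mem _ (hvd ω) _ _ (hp ω)))

end Measurability

/-! ### Almost sure and pathwise convergence of series. -/

section Convergence

variable {Ω : Type*} {m0 : MeasurableSpace Ω} {P : Measure Ω}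

/-- By Tonelli the sum has finite integral, hence is finite almost everywhere. -/
lemma ae_summable_of_summable_integral {h : ℕ → Ω → ℝ} (h0 : ∀ t ω, 0 ≤ h t ω)
    (hi : ∀ t, Integrable (h t) P) (hs : Summable fun t => ∫ ω, h t ω ∂P) :
    ∀ᵐ ω ∂P, Summable fun t => h t ω := by
  have h1 : ∫⁻ ω, ∑' t, ENNReal.ofReal (h t ω) ∂P ≠ ⊤ := by
    rw [lintegral_tsum fun t => (hi t).aestronglyMeasurable.aemeasurable.ennreal_ofReal]
    simp_rw [← ofReal_integral_eq_lintegral_ofReal (hi _) (Eventually.of_forall (h0 _))]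
    exact hs.tsum_ofReal_ne_top
  have h2 := ae_lt_top' (AEMeasurable.tsum
    fun t => (hi t).aestronglyMeasurable.aemeasurable.ennreal_ofReal) h1
  filter_upwards [h2] with ω hω
  refine (ENNReal.summable_toReal hω.ne).congr fun t => ?_
  rw [ENNReal.toReal_ofReal (h0 t ω)]

/-- Almost sure convergence of a series of square integrable martingale differences. -/
lemma ae_tendsto_sum_of_martingale_difference [IsProbabilityMeasure P] {ℱ : Filtration ℕ m0}
    {ε : ℕ → Ω → ℝ} (hm : ∀ t, StronglyMeasurable[ℱ (t + 1)] (ε t)) (h2 : ∀ t, MemLp (ε t) 2 P)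
    (hc : ∀ t, P[ε t | ℱ t] =ᵐ[P] 0) (hs : Summable fun t => ∫ ω, ε t ω ^ 2 ∂P) :
    ∀ᵐ ω ∂P, ∃ c, Tendsto (fun T => ∑ t ∈ Finset.range T, ε t ω) atTop (𝓝 c) := by
  set S : ℕ → Ω → ℝ := fun T => ∑ t ∈ Finset.range T, ε t
  have hSm : ∀ T, StronglyMeasurable[ℱ T] (S T) := fun T =>
    Finset.stronglyMeasurable_sum _ fun t ht =>
      (hm t).mono (ℱ.mono (Nat.succ_le_of_lt (Finset.mem_range.1 ht)))
  have hS2 : ∀ T, MemLp (S T) 2 P := fun T => memLp_finsetSum' _ fun t _ => h2 t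
  have hS1 : ∀ T, Integrable (S T) P := fun T => (hS2 T).integrable one_le_two
  have hε1 : ∀ t, Integrable (ε t) P := fun t => (h2 t).integrable one_le_two
  have hsucc : ∀ T, S (T + 1) = S T + ε T := fun T => Finset.sum_range_succ _ _
  have hmart : Martingale S ℱ P := by
    refine martingale_nat hSm hS1 fun T => ?_
    rw [hsucc]
    have h3 := condExp_add (hS1 T) (hε1 T) (ℱ T)
    rw [condExp_of_stronglyMeasurable (ℱ.le T) (hSm T) (hS1 T)] at h3
    filter_upwards [h3, hc T] with ω h4 h5
    rw [h4, Pi.add_apply, h5, Pi.zero_apply, add_zero]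
  -- Increments are orthogonal to the past, so variances add; this bounds the martingale in L²,
  -- hence in L¹.
  have horth : ∀ T, ∫ ω, S T ω * ε T ω ∂P = 0 := by
    intro T
    have h3 := condExp_mul_of_stronglyMeasurable_left (hSm T) ((hS2 T).integrable_mul (h2 T))
      (hε1 T)
    have h4 : ∫ ω, (P[S T * ε T | ℱ T]) ω ∂P = ∫ ω, (S T * ε T) ω ∂P := integral_condExp (ℱ.le T)
    change ∫ ω, (S T * ε T) ω ∂P = 0
    rw [← h4]
    refine integral_eq_zero_of_ae ?_
    filter_upwards [h3, hc T] with ω h5 h6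
    rw [h5, Pi.mul_apply, h6, Pi.zero_apply, mul_zero]
  have hsq : ∀ T, ∫ ω, S T ω ^ 2 ∂P = ∑ t ∈ Finset.range T, ∫ ω, ε t ω ^ 2 ∂P := by
    intro T
    induction T with
    | zero => simp [S]
    | succ T ih =>
      rw [Finset.sum_range_succ, ← ih, hsucc]
      have e1 : ∀ ω, (S T + ε T) ω ^ 2 = S T ω ^ 2 + (2 * (S T ω * ε T ω) + ε T ω ^ 2) := by
        intro ω; rw [Pi.add_apply]; ring
      simp_rw [e1]
      rw [integral_add, integral_add, integral_const_mul, horth]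
      · ring
      · exact ((hS2 T).integrable_mul (h2 T)).const_mul 2
      · exact (h2 T).integrable_sq
      · exact (hS2 T).integrable_sq
      · exact (((hS2 T).integrable_mul (h2 T)).const_mul 2).add (h2 T).integrable_sq
  set C : ℝ := ∑' t, ∫ ω, ε t ω ^ 2 ∂P
  have hbdd : ∀ T, eLpNorm (S T) 1 P ≤ ((1 + C) / 2).toNNReal := by
    intro T
    rw [eLpNorm_one_eq_lintegral_enorm, ← ofReal_integral_norm_eq_lintegral_enorm (hS1 T)]
    refine ENNReal.ofReal_le_ofReal ?_
    have h3 : ∫ ω, S T ω ^ 2 ∂P ≤ C := by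
      rw [hsq]
      exact hs.sum_le_tsum _ fun t _ => integral_nonneg fun ω => sq_nonneg _
    calc ∫ ω, ‖S T ω‖ ∂P ≤ ∫ ω, (1 + S T ω ^ 2) / 2 ∂P := by
          refine integral_mono (hS1 T).norm
            (((integrable_const _).add (hS2 T).integrable_sq).div_const _) fun ω => ?_
          change ‖S T ω‖ ≤ (1 + S T ω ^ 2) / 2
          rw [Real.norm_eq_abs]
          nlinarith [sq_nonneg (|S T ω| - 1), sq_abs (S T ω)]
      _ = (1 + ∫ ω, S T ω ^ 2 ∂P) / 2 := by
          rw [integral_div, integral_add (integrable_const _) (hS2 T).integrable_sq]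
          simp
      _ ≤ _ := by linarith
  filter_upwards [hmart.submartingale.exists_ae_tendsto_of_bdd hbdd] with ω ⟨c, hω⟩
  refine ⟨c, hω.congr fun T => ?_⟩
  simp [S]

/-- Pathwise form of the Robbins-Siegmund lemma. -/
lemma exists_tendsto_of_descent {V a c m : ℕ → ℝ} (hV : ∀ t, 0 ≤ V t) (ha : ∀ t, 0 ≤ a t)
    (hc : Summable c) (hm : ∃ l, Tendsto (fun T => ∑ t ∈ Finset.range T, m t) atTop (𝓝 l))
    (h : ∀ t, V (t + 1) ≤ V t - a t + c t + m t) :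
    (∃ l, Tendsto V atTop (𝓝 l)) ∧ Summable a := by
  obtain ⟨lm, hm⟩ := hm
  set Z : ℕ → ℝ := fun T => ∑ t ∈ Finset.range T, c t + ∑ t ∈ Finset.range T, m t
  have hZ : Tendsto Z atTop (𝓝 (∑' t, c t + lm)) := hc.hasSum.tendsto_sum_nat.add hm
  obtain ⟨K, hK⟩ := hZ.bddAbove_range
  have hK : ∀ T, Z T ≤ K := fun T => hK ⟨T, rfl⟩
  -- V without the accumulated errors and with the accumulated decrease restored is nonincreasing
  -- and bounded below.
  set Y : ℕ → ℝ := fun T => V T - Z T + ∑ t ∈ Finset.range T, a t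
  have hY : Antitone Y := antitone_nat_of_succ_le fun T => by
    simp only [Y, Z, Finset.sum_range_succ]
    linarith [h T]
  have hpos : ∀ T, 0 ≤ ∑ t ∈ Finset.range T, a t := fun T => Finset.sum_nonneg fun t _ => ha t
  have hYb : BddBelow (Set.range Y) := by
    refine ⟨-K, ?_⟩
    rintro _ ⟨T, rfl⟩
    simp only [Y]; linarith [hV T, hK T, hpos T]
  have hsa : Summable a := by
    refine summable_of_sum_range_le (c := Y 0 + K) ha fun T => ?_
    have h1 := hY (Nat.zero_le T)
    have h2 : Y T = V T - Z T + ∑ t ∈ Finset.range T, a t := rfl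
    linarith [hV T, hK T]
  refine ⟨⟨_, (((tendsto_atTop_ciInf hY hYb).add hZ).sub hsa.hasSum.tendsto_sum_nat).congr
    fun T => ?_⟩, hsa⟩
  simp only [Y]; ring

/-- If b stayed above some positive constant eventually, summability of ab would force that of a. -/
lemma exists_subseq_tendsto_zero {a b : ℕ → ℝ} (ha : ∀ t, 0 ≤ a t) (hb : ∀ t, 0 ≤ b t)
    (hab : Summable fun t => a t * b t) (hna : ¬ Summable a) :
    ∃ φ : ℕ → ℕ, StrictMono φ ∧ Tendsto (fun k => b (φ k)) atTop (𝓝 0) := by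
  have hfreq : ∀ k : ℕ, ∃ᶠ t in atTop, b t < ((k : ℝ) + 1)⁻¹ := by
    intro k hk
    refine hna ?_
    obtain ⟨N, hN⟩ := eventually_atTop.1 hk
    have hk0 : (0 : ℝ) < (k : ℝ) + 1 := by positivity
    rw [← summable_nat_add_iff N]
    refine (((summable_nat_add_iff N).2 hab).mul_left ((k : ℝ) + 1)).of_nonneg_of_le
      (fun t => ha _) fun t => ?_
    have h1 := not_lt.1 (hN (t + N) (Nat.le_add_left _ _))
    have h2 : 1 ≤ ((k : ℝ) + 1) * b (t + N) := by
      have := mul_le_mul_of_nonneg_left h1 hk0.le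
      rwa [mul_inv_cancel₀ hk0.ne'] at this
    nlinarith [ha (t + N)]
  obtain ⟨φ, hφ, h⟩ := extraction_forall_of_frequently hfreq
  refine ⟨φ, hφ, squeeze_zero (fun k => hb _) (fun k => (h k).le) ?_⟩
  exact tendsto_inv_atTop_zero.comp
    (tendsto_atTop_add_const_right _ _ tendsto_natCast_atTop_atTop)

end Convergence

/-! ### Nash equilibria and the duality gap. -/

section GameLemmas

lemma profile_ext {E : Fin 2 → Type*} {x y : ∀ k, E k} (h0 : x 0 = y 0) (h1 : x 1 = y 1) :
    x = y := funext (Fin.forall_fin_two.2 ⟨h0, h1⟩)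

lemma update_one_eq_update_zero {E : Fin 2 → Type*} (x y : ∀ k, E k) :
    Function.update x 1 (y 1) = Function.update y 0 (x 0) :=
  profile_ext (by simp) (by simp)

lemma update_mem_pi {E : Fin 2 → Type*} {X : ∀ k, Set (E k)} {x : ∀ k, E k}
    (hx : x ∈ Set.univ.pi X) {l : Fin 2} {y : E l} (hy : y ∈ X l) :
    Function.update x l y ∈ Set.univ.pi X := by
  intro k _
  by_cases h : k = l
  · subst h; simpa using hy
  · simpa [h] using hx k trivial

variable {Ω : Type*} [MeasurableSpace Ω] {P : Measure Ω}
  {E : Fin 2 → Type*} [∀ l, NormedAddCommGroup (E l)] [∀ l, NormedSpace ℝ (E l)]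
  {n : Fin 2 → ℕ} {d : ℕ} (Γ : Game E P n d)

lemma Game.continuousOn_U : ContinuousOn Γ.U (Set.univ.pi Γ.X) :=
  (continuousOn_finsetSum _ fun i _ => Γ.cost_continuous 0 i).const_mul _

variable {Γ}

theorem Game.StrictConvexConcave.exists_isNash (hU : Γ.StrictConvexConcave) :
    ∃ x, Γ.IsNash x := by
  obtain ⟨x0, hx0⟩ : (Set.univ.pi Γ.X).Nonempty := Set.univ_pi_nonempty_iff.2 Γ.nonempty
  set p : E 0 → E 1 → ∀ k, E k := fun a b => Function.update (Function.update x0 0 a) 1 b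
  have hp : ∀ a ∈ Γ.X 0, ∀ b ∈ Γ.X 1, p a b ∈ Set.univ.pi Γ.X := fun a ha b hb =>
    update_mem_pi (update_mem_pi hx0 ha) hb
  have hp0 : ∀ a b a', Function.update (p a b) 0 a' = p a' b := fun a b a' =>
    profile_ext (by simp [p]) (by simp [p])
  have hp1 : ∀ a b b', Function.update (p a b) 1 b' = p a b' := fun a b b' =>
    profile_ext (by simp [p]) (by simp [p])
  have hpc : Continuous fun z : E 0 × E 1 => p z.1 z.2 :=
    (continuous_const.update 0 continuous_fst).update 1 continuous_snd
  obtain ⟨a, ha, b, hb, h1, h2⟩ := exists_saddle (u := fun a b => Γ.U (p a b)) (Γ.compact 0)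
    (Γ.compact 1) (Γ.nonempty 0) (Γ.nonempty 1)
    (Γ.continuousOn_U.comp hpc.continuousOn fun z hz => hp _ hz.1 _ hz.2)
    (fun b hb => by
      obtain ⟨a, ha⟩ := Γ.nonempty 0
      simpa only [hp0] using (hU _ (hp a ha b hb)).1)
    (fun a ha => by
      obtain ⟨b, hb⟩ := Γ.nonempty 1
      simpa only [hp1] using (hU _ (hp a ha b hb)).2.concaveOn)
  refine ⟨p a b, hp a ha b hb, fun y hy => ?_, fun y hy => ?_⟩
  · rw [hp1]; exact h1 y hy
  · rw [hp0]; exact h2 y hy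

/-- The duality gap of `z` relative to the profile `x`. -/
def Game.gap (Γ : Game E P n d) (x z : ∀ k, E k) : ℝ :=
  Γ.U (Function.update x 0 (z 0)) - Γ.U (Function.update x 1 (z 1))

lemma Game.IsNash.gap_nonneg {x z : ∀ k, E k} (hx : Γ.IsNash x) (hz : z ∈ Set.univ.pi Γ.X) :
    0 ≤ Γ.gap x z :=
  sub_nonneg.2 ((hx.2.1 _ (hz 1 trivial)).trans (hx.2.2 _ (hz 0 trivial)))

/-- The gap is the sum of both players' nonnegative losses from deviating to z. Both vanish, so z 0
and z 1 are the unique optima against x. -/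
lemma Game.IsNash.eq_of_gap_nonpos (hU : Γ.StrictConvexConcave) {x z : ∀ k, E k}
    (hx : Γ.IsNash x) (hz : z ∈ Set.univ.pi Γ.X) (h : Γ.gap x z ≤ 0) : z = x := by
  have h1 := hx.2.1 _ (hz 1 trivial)
  have h0 := hx.2.2 _ (hz 0 trivial)
  unfold Game.gap at h
  have e0 : Γ.U (Function.update x 0 (z 0)) = Γ.U x := by linarith
  have e1 : Γ.U (Function.update x 1 (z 1)) = Γ.U x := by linarith
  refine profile_ext ?_ ?_
  · refine (hU x hx.1).1.eq_of_isMinOn (fun y hy => ?_) (fun y hy => ?_) (hz 0 trivial)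
      (hx.1 0 trivial)
    · change Γ.U (Function.update x 0 (z 0)) ≤ Γ.U (Function.update x 0 y)
      rw [e0]; exact hx.2.2 y hy
    · change Γ.U (Function.update x 0 (x 0)) ≤ Γ.U (Function.update x 0 y)
      rw [Function.update_eq_self]; exact hx.2.2 y hy
  · refine (hU x hx.1).2.eq_of_isMaxOn (fun y hy => ?_) (fun y hy => ?_) (hz 1 trivial)
      (hx.1 1 trivial)
    · change Γ.U (Function.update x 1 y) ≤ Γ.U (Function.update x 1 (z 1))
      rw [e1]; exact hx.2.1 y hy
    · change Γ.U (Function.update x 1 y) ≤ Γ.U (Function.update x 1 (x 1))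
      rw [Function.update_eq_self]; exact hx.2.1 y hy

lemma Game.IsNash.unique (hU : Γ.StrictConvexConcave) {x y : ∀ k, E k} (hx : Γ.IsNash x)
    (hy : Γ.IsNash y) : y = x := by
  refine hx.eq_of_gap_nonpos hU hy.1 ?_
  have h1 := hy.2.1 _ (hx.1 1 trivial)
  have h0 := hy.2.2 _ (hx.1 0 trivial)
  unfold Game.gap
  rw [update_one_eq_update_zero] at h1
  rw [← update_one_eq_update_zero] at h0
  linarith

lemma Game.continuousOn_gap {x : ∀ k, E k} (hx : x ∈ Set.univ.pi Γ.X) :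
    ContinuousOn (Γ.gap x) (Set.univ.pi Γ.X) := by
  refine ContinuousOn.sub ?_ ?_
  · exact Γ.continuousOn_U.comp (f := fun z : ∀ k, E k => Function.update x 0 (z 0))
      (continuous_const.update 0 (continuous_apply 0)).continuousOn
      fun z hz => update_mem_pi hx (hz 0 trivial)
  · exact Γ.continuousOn_U.comp (f := fun z : ∀ k, E k => Function.update x 1 (z 1))
      (continuous_const.update 1 (continuous_apply 1)).continuousOn
      fun z hz => update_mem_pi hx (hz 1 trivial)

/-- The averaged costs of the two networks are U and −U, so the two terms U(z) cancel. -/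
lemma Game.sum_cost_sub {x z : ∀ k, E k} (hx : x ∈ Set.univ.pi Γ.X)
    (hz : z ∈ Set.univ.pi Γ.X) :
    ∑ l, (1 / (n l : ℝ)) * ∑ i, (Γ.f l i (Function.update z l (x l)) - Γ.f l i z) =
      -Γ.gap x z := by
  have h1 := Γ.zero_sum z hz
  have h2 := Γ.zero_sum _ (update_mem_pi hz (hx 1 trivial))
  rw [Fin.sum_univ_two]
  simp only [Finset.sum_sub_distrib, mul_sub]
  unfold Game.gap Game.U
  rw [update_one_eq_update_zero x z, ← update_one_eq_update_zero z x]
  unfold Game.f at *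
  linarith

end GameLemmas

/-! ### Pathwise estimates along a run. -/

section RunLemmas

variable {Ω : Type*} [MeasurableSpace Ω] {P : Measure Ω}
  {E : Fin 2 → Type*} [∀ l, NormedAddCommGroup (E l)] [∀ l, NormedSpace ℝ (E l)]
  {n : Fin 2 → ℕ} {d : ℕ}

lemma Network.weight_nonneg (N : Network n) (l k : Fin 2) (t : ℕ) (i : Fin (n l))
    (j : Fin (n k)) : 0 ≤ N.W l k t i j := by
  by_cases h : k = l
  · subst h
    by_cases hG : (N.G k t).Adj j i
    · exact N.η_pos.le.trans (N.weight_ge k t i j hG)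
    · exact (N.weight_zero k t i j hG).ge
  · exact N.cross_nonneg l k t i j h

lemma Game.sum_mean_weight (Γ : Game E P n d) (k : Fin 2) :
    ∑ _j : Fin (n k), (1 / (n k : ℝ)) = 1 := by
  have : (n k : ℝ) ≠ 0 := by exact_mod_cast (Γ.agents_pos k).ne'
  simp [this]

variable [∀ l, MeasurableSpace (E l)] {Γ : Game E P n d} {N : Network n}
  {R : ∀ l, Regularizer (Γ.X l)} {α : ℕ → ℝ} (r : Run Γ N R α)

/-- The point at which agent `i` of subnetwork `l` samples at time `t`. -/
def Run.point (l : Fin 2) (i : Fin (n l)) (t : ℕ) (ω : Ω) : ∀ k, E k :=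
  estimate N t (fun k j => r.x k j t ω) l i

/-- The mean strategies of the two subnetworks. -/
def Run.mean (t : ℕ) (ω : Ω) : ∀ k, E k :=
  fun k => ∑ j, (1 / (n k : ℝ)) • r.x k j t ω

section Dom

variable {r}

lemma Run.point_mem_dom_of (hA3 : ∀ l, (R l).Reciprocal) {t : ℕ} {ω : Ω}
    (h : ∀ l i, r.x l i t ω ∈ (R l).dom) (l : Fin 2) (i : Fin (n l)) (k : Fin 2) :
    r.point l i t ω k ∈ (R k).dom := by
  obtain ⟨x, hx⟩ := Γ.nonempty k
  exact ((hA3 k).convex_right x hx).1.sum_mem (fun j _ => N.weight_nonneg l k t i j)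
    (N.row_sum l k t i) fun j _ => h k j

lemma Run.mem_dom (hA3 : ∀ l, (R l).Reciprocal) (t : ℕ) (ω : Ω) :
    ∀ l i, r.x l i t ω ∈ (R l).dom := by
  induction t with
  | zero => exact fun l i => r.init_mem l i ω
  | succ t ih => exact fun l i =>
      (R l).prox_mem _ (Run.point_mem_dom_of hA3 ih l i l) _ _ (r.step l i t ω)

lemma Run.point_mem_dom (hA3 : ∀ l, (R l).Reciprocal) (l : Fin 2) (i : Fin (n l)) (t : ℕ) (ω : Ω)
    (k : Fin 2) : r.point l i t ω k ∈ (R k).dom :=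
  Run.point_mem_dom_of hA3 (Run.mem_dom hA3 t ω) l i k

lemma Run.point_mem (hA3 : ∀ l, (R l).Reciprocal) (l : Fin 2) (i : Fin (n l)) (t : ℕ) (ω : Ω) :
    r.point l i t ω ∈ Set.univ.pi Γ.X :=
  fun k _ => (R k).dom_subset (Run.point_mem_dom hA3 l i t ω k)

lemma Run.mean_mem (hA3 : ∀ l, (R l).Reciprocal) (t : ℕ) (ω : Ω) :
    r.mean t ω ∈ Set.univ.pi Γ.X :=
  fun k _ => (Γ.convex k).sum_mem (fun _ _ => by positivity) (Γ.sum_mean_weight k)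
    fun j _ => (R k).dom_subset (Run.mem_dom hA3 t ω k j)

lemma Run.norm_point_sub_mean_le (l : Fin 2) (i : Fin (n l)) (t : ℕ) (ω : Ω) (k : Fin 2) :
    ‖r.point l i t ω k - r.mean t ω k‖ ≤ disagreement fun j => r.x k j t ω := by
  have := norm_sum_sub_sum_le (fun j => r.x k j t ω) (ε := 0)
    (fun j => N.weight_nonneg l k t i j) (q := fun _ => 1 / (n k : ℝ)) (fun _ => by positivity)
    (N.row_sum l k t i) (Γ.sum_mean_weight k)
  simpa [Run.point, Run.mean, estimate] using this

lemma Run.norm_sub_mean_le (t : ℕ) (ω : Ω) (k : Fin 2) (i : Fin (n k)) :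
    ‖r.x k i t ω - r.mean t ω k‖ ≤ disagreement fun j => r.x k j t ω := by
  have := norm_sum_sub_sum_le (fun j => r.x k j t ω) (ε := 0) (p := fun j => if j = i then 1 else 0)
    (fun j => by split_ifs <;> norm_num) (q := fun _ => 1 / (n k : ℝ)) (fun _ => by positivity)
    (by simp) (Γ.sum_mean_weight k)
  simpa [Run.mean] using this

lemma Run.norm_step_le (hα : ∀ t, 0 ≤ α t) (hA3 : ∀ l, (R l).Reciprocal) (l : Fin 2)
    (i : Fin (n l)) (t : ℕ) (ω : Ω) :
    ‖r.x l i (t + 1) ω - r.point l i t ω l‖ ≤ α t * ‖r.ghat l i t ω‖ := by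
  have h := (r.step l i t ω).norm_sub_le (R l).strongConvexOn
    ((R l).dom_subset (Run.point_mem_dom hA3 l i t ω l))
    ((R l).differentiable _ (Run.mem_dom hA3 (t + 1) ω l i))
    ((R l).differentiable _ (Run.point_mem_dom hA3 l i t ω l))
  rwa [norm_neg, norm_smul, Real.norm_of_nonneg (hα t)] at h

/-- A run is a consensus iteration perturbed by its prox displacement, which is at most α‖ĝ‖. -/
lemma Run.summable_disagreement_sq (hα : ∀ t, 0 ≤ α t) (hA3 : ∀ l, (R l).Reciprocal) {ω : Ω}
    (hs : ∀ l i, Summable fun t => α t ^ 2 * ‖r.ghat l i t ω‖ ^ 2) (l : Fin 2) :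
    Summable fun t => disagreement (fun i => r.x l i t ω) ^ 2 := by
  obtain ⟨B, -, hB⟩ := N.jointly_connected l
  have : Nonempty (Fin (n l)) := ⟨⟨0, Γ.agents_pos l⟩⟩
  refine DSMD.summable_disagreement_sq (G := fun t => (N.G l t).Adj) N.η_pos
    (fun t => N.weight_nonneg l l t) (N.row_sum l l) (N.weight_ge l) (N.self_loop l) hB
    (x := fun t i => r.x l i t ω) (e := fun t i => r.x l i (t + 1) ω - r.point l i t ω l)
    (fun t i => ?_) fun i => ?_
  · simp [Run.point, estimate]
  · refine (hs l i).of_nonneg_of_le (fun t => sq_nonneg _) fun t => ?_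
    rw [← mul_pow]
    exact pow_le_pow_left₀ (norm_nonneg _) (Run.norm_step_le hα hA3 l i t ω) 2

/-- The averaged Bregman divergence of `z` from the strategies at time `t`. -/
def Run.divergence (r : Run Γ N R α) (z : ∀ k, E k) (t : ℕ) (ω : Ω) : ℝ :=
  ∑ l, (1 / (n l : ℝ)) * ∑ i, bregman (Γ.X l) (R l).ψ (z l) (r.x l i t ω)

/-- Jensen in the second argument, using row sums, followed by column sums equal to 1. -/
lemma Run.sum_bregman_point_le (hA3 : ∀ l, (R l).Reciprocal) {l : Fin 2} {z : E l}
    (hz : z ∈ Γ.X l) (t : ℕ) (ω : Ω) :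
    ∑ i, bregman (Γ.X l) (R l).ψ z (r.point l i t ω l) ≤
      ∑ i, bregman (Γ.X l) (R l).ψ z (r.x l i t ω) := by
  calc _ ≤ ∑ i, ∑ j, N.W l l t i j * bregman (Γ.X l) (R l).ψ z (r.x l j t ω) := by
        refine Finset.sum_le_sum fun i _ => ?_
        exact ((hA3 l).convex_right z hz).map_sum_le (fun j _ => N.weight_nonneg l l t i j)
          (N.row_sum l l t i) fun j _ => Run.mem_dom hA3 t ω l j
    _ = _ := by
        rw [Finset.sum_comm]
        simp_rw [← Finset.sum_mul, N.col_sum, one_mul]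

/-- Both cost values are moved from the agent's own sampling point to the common mean, each at the
price L times the total disagreement. -/
lemma Run.subgradient_le {L : ℝ} (hL : 0 ≤ L) (hLip : Γ.LipschitzCosts L)
    (hA3 : ∀ l, (R l).Reciprocal) {g : ∀ l, Fin (n l) → ℕ → Ω → StrongDual ℝ (E l)}
    (hg : r.IsCostSubgradient L g) {z : ∀ k, E k} (hz : z ∈ Set.univ.pi Γ.X) (l : Fin 2)
    (i : Fin (n l)) (t : ℕ) (ω : Ω) :
    g l i t ω (z l - r.point l i t ω l) ≤
      Γ.f l i (Function.update (r.mean t ω) l (z l)) - Γ.f l i (r.mean t ω) +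
        2 * L * ∑ k, disagreement fun j => r.x k j t ω := by
  have h1 := (hg l i t ω).1 (z l) (hz l trivial)
  change Γ.f l i (Function.update (r.point l i t ω) l (r.point l i t ω l)) + _ ≤
    Γ.f l i (Function.update (r.point l i t ω) l (z l)) at h1
  rw [Function.update_eq_self] at h1
  change Γ.f l i (r.point l i t ω) + g l i t ω (z l - r.point l i t ω l) ≤ _ at h1
  have hd : ∀ k, ‖r.point l i t ω k - r.mean t ω k‖ ≤ disagreement fun j => r.x k j t ω :=
    Run.norm_point_sub_mean_le l i t ω
  have hu : ∀ k, ‖Function.update (r.point l i t ω) l (z l) k -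
      Function.update (r.mean t ω) l (z l) k‖ ≤ disagreement fun j => r.x k j t ω := by
    intro k
    by_cases h : k = l
    · subst h; simpa using disagreement_nonneg _
    · simpa [h] using hd k
  have hp := Run.point_mem hA3 (r := r) l i t ω
  have hm := Run.mean_mem hA3 (r := r) t ω
  have h2 := hLip l i _ hp _ hm
  have h3 := hLip l i _ (update_mem_pi hp (hz l trivial)) _ (update_mem_pi hm (hz l trivial))
  have h4 := h2.trans (mul_le_mul_of_nonneg_left (add_le_add (hd 0) (hd 1)) hL)
  have h5 := h3.trans (mul_le_mul_of_nonneg_left (add_le_add (hu 0) (hu 1)) hL)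
  rw [Fin.sum_univ_two]
  linarith [abs_le.1 h4, abs_le.1 h5]

lemma Run.divergence_succ_le (hα : ∀ t, 0 ≤ α t) {L : ℝ} (hL : 0 ≤ L)
    (hLip : Γ.LipschitzCosts L) (hA3 : ∀ l, (R l).Reciprocal)
    {g : ∀ l, Fin (n l) → ℕ → Ω → StrongDual ℝ (E l)} (hg : r.IsCostSubgradient L g)
    {z : ∀ k, E k} (hz : z ∈ Set.univ.pi Γ.X) (t : ℕ) (ω : Ω) :
    r.divergence z (t + 1) ω ≤ r.divergence z t ω - α t * Γ.gap z (r.mean t ω) +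
      (∑ l, (1 / (n l : ℝ)) * ∑ i, (α t * (2 * L * ∑ k, disagreement fun j => r.x k j t ω) +
        α t ^ 2 * ‖r.ghat l i t ω‖ ^ 2 / 2)) +
      ∑ l, (1 / (n l : ℝ)) * ∑ i,
        α t * (r.ghat l i t ω - g l i t ω) (z l - r.point l i t ω l) := by
  have hagent : ∀ l i, bregman (Γ.X l) (R l).ψ (z l) (r.x l i (t + 1) ω) ≤
      bregman (Γ.X l) (R l).ψ (z l) (r.point l i t ω l) +
      α t * (Γ.f l i (Function.update (r.mean t ω) l (z l)) - Γ.f l i (r.mean t ω)) +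
      (α t * (2 * L * ∑ k, disagreement fun j => r.x k j t ω) +
        α t ^ 2 * ‖r.ghat l i t ω‖ ^ 2 / 2) +
      α t * (r.ghat l i t ω - g l i t ω) (z l - r.point l i t ω l) := by
    intro l i
    have h1 := (r.step l i t ω).bregman_le (R l).strongConvexOn
      ((R l).dom_subset (Run.point_mem_dom hA3 l i t ω l)) (hz l trivial)
      ((R l).differentiable _ (Run.mem_dom hA3 (t + 1) ω l i))
      ((R l).differentiable _ (Run.point_mem_dom hA3 l i t ω l))
    rw [norm_neg, norm_smul, Real.norm_of_nonneg (hα t), mul_pow] at h1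
    change _ ≤ bregman (Γ.X l) (R l).ψ (z l) (r.point l i t ω l) -
      -(α t * r.ghat l i t ω (z l - r.point l i t ω l)) + _ at h1
    have h2 := mul_le_mul_of_nonneg_left (Run.subgradient_le hL hLip hA3 hg hz l i t ω) (hα t)
    rw [sub_apply]
    linarith
  have hsum := Game.sum_cost_sub hz (Run.mean_mem (r := r) hA3 t ω)
  have hl : ∀ l, (1 / (n l : ℝ)) * ∑ i, bregman (Γ.X l) (R l).ψ (z l) (r.x l i (t + 1) ω) ≤
      (1 / (n l : ℝ)) * ∑ i, bregman (Γ.X l) (R l).ψ (z l) (r.x l i t ω) +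
      α t * ((1 / (n l : ℝ)) * ∑ i,
        (Γ.f l i (Function.update (r.mean t ω) l (z l)) - Γ.f l i (r.mean t ω))) +
      (1 / (n l : ℝ)) * ∑ i, (α t * (2 * L * ∑ k, disagreement fun j => r.x k j t ω) +
        α t ^ 2 * ‖r.ghat l i t ω‖ ^ 2 / 2) +
      (1 / (n l : ℝ)) * ∑ i,
        α t * (r.ghat l i t ω - g l i t ω) (z l - r.point l i t ω l) := by
    intro l
    have h1 := Finset.sum_le_sum fun i (_ : i ∈ Finset.univ) => hagent l i
    have h2 := Run.sum_bregman_point_le (r := r) hA3 (hz l trivial) t ω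
    rw [Finset.sum_add_distrib, Finset.sum_add_distrib, Finset.sum_add_distrib,
      ← Finset.mul_sum (a := α t)] at h1
    have h3 : (0 : ℝ) ≤ 1 / n l := by positivity
    have h4 := mul_le_mul_of_nonneg_left (h1.trans (add_le_add_left (add_le_add_left
      (add_le_add_left h2 _) _) _)) h3
    linarith
  have h := Finset.sum_le_sum fun l (_ : l ∈ Finset.univ) => hl l
  rw [Finset.sum_add_distrib, Finset.sum_add_distrib, Finset.sum_add_distrib,
    ← Finset.mul_sum, hsum] at h
  unfold Run.divergence
  linarith

end Dom

end RunLemmas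

/-! ### Pathwise convergence, adaptedness and the noise series. -/

section Stochastic

variable {Ω : Type*} [mΩ : MeasurableSpace Ω] {P : Measure Ω}
  {E : Fin 2 → Type*} [∀ l, NormedAddCommGroup (E l)] [∀ l, NormedSpace ℝ (E l)]
  [∀ l, MeasurableSpace (E l)] {n : Fin 2 → ℕ} {d : ℕ} {Γ : Game E P n d} {N : Network n}
  {R : ∀ l, Regularizer (Γ.X l)} {α : ℕ → ℝ} {r : Run Γ N R α}

variable (r) in
lemma Run.info_mono : Monotone r.info := by
  intro s t hst
  rw [r.info_eq, r.info_eq]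
  exact sup_le_sup le_rfl (iSup_mono fun u => iSup_mono' fun h => ⟨h.trans_le hst, le_rfl⟩)

variable (r) in
lemma Run.info_le (t : ℕ) : r.info t ≤ mΩ := by
  rw [r.info_eq]
  refine sup_le (iSup_le fun l => iSup_le fun i => (r.init_measurable l i).comap_le) ?_
  exact iSup_le fun s => iSup_le fun _ => iSup_le fun l => iSup_le fun i =>
    (r.sample_measurable l i s).comap_le

variable (r) in
/-- The filtration of the information available to the agents. -/
def Run.filtration : Filtration ℕ mΩ := ⟨r.info, r.info_mono, r.info_le⟩

/-- Convergence of a run along a sample path on which the noise series converges. -/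
lemma Run.tendsto_of_summable (hα : ∀ t, 0 ≤ α t) (hα_sq : Summable fun t => α t ^ 2)
    (hα_sum : ¬ Summable α) (hU : Γ.StrictConvexConcave) {L : ℝ} (hL : 0 ≤ L)
    (hLip : Γ.LipschitzCosts L) (hA3 : ∀ l, (R l).Reciprocal)
    {g : ∀ l, Fin (n l) → ℕ → Ω → StrongDual ℝ (E l)} (hg : r.IsCostSubgradient L g)
    {z : ∀ k, E k} (hz : Γ.IsNash z) {ω : Ω}
    (hs : ∀ l i, Summable fun t => α t ^ 2 * ‖r.ghat l i t ω‖ ^ 2)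
    (hn : ∀ l i, ∃ c, Tendsto (fun T => ∑ t ∈ Finset.range T,
      α t * (r.ghat l i t ω - g l i t ω) (z l - r.point l i t ω l)) atTop (𝓝 c))
    (l : Fin 2) (i : Fin (n l)) : Tendsto (fun t => r.x l i t ω) atTop (𝓝 (z l)) := by
  have hD : ∀ k, Summable fun t => disagreement (fun j => r.x k j t ω) ^ 2 :=
    Run.summable_disagreement_sq hα hA3 hs
  have hD0 : ∀ k, Tendsto (fun t => disagreement fun j => r.x k j t ω) atTop (𝓝 0) := by
    intro k
    have := (hD k).tendsto_atTop_zero.sqrt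
    simpa [Real.sqrt_sq (disagreement_nonneg _)] using this
  -- From αD ≤ (α² + D²)/2.
  have hαD : ∀ k, Summable fun t => α t * disagreement fun j => r.x k j t ω := fun k =>
    ((hα_sq.add (hD k)).div_const 2).of_nonneg_of_le
      (fun t => mul_nonneg (hα t) (disagreement_nonneg _)) fun t => by
        nlinarith [sq_nonneg (α t - disagreement fun j => r.x k j t ω)]
  have hbreg : ∀ l i t, ‖z l - r.x l i t ω‖ ^ 2 / 2 ≤
      bregman (Γ.X l) (R l).ψ (z l) (r.x l i t ω) := fun l i t =>
    norm_sq_le_bregman (R l).strongConvexOn ((R l).dom_subset (Run.mem_dom hA3 t ω l i))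
      (hz.1 l trivial) ((R l).differentiable _ (Run.mem_dom hA3 t ω l i))
  have hbreg0 : ∀ l i t, 0 ≤ bregman (Γ.X l) (R l).ψ (z l) (r.x l i t ω) := fun l i t =>
    le_trans (by positivity) (hbreg l i t)
  choose c hc using hn
  obtain ⟨⟨v, hv⟩, hgap⟩ := exists_tendsto_of_descent
    (V := fun t => r.divergence z t ω) (a := fun t => α t * Γ.gap z (r.mean t ω))
    (c := fun t => ∑ l, (1 / (n l : ℝ)) * ∑ i : Fin (n l),
      (α t * (2 * L * ∑ k, disagreement fun j => r.x k j t ω) +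
        α t ^ 2 * ‖r.ghat l i t ω‖ ^ 2 / 2))
    (m := fun t => ∑ l, (1 / (n l : ℝ)) * ∑ i, α t * (r.ghat l i t ω - g l i t ω)
      (z l - r.point l i t ω l))
    (fun t => Finset.sum_nonneg fun l _ => mul_nonneg (by positivity)
      (Finset.sum_nonneg fun i _ => hbreg0 l i t))
    (fun t => mul_nonneg (hα t) (hz.gap_nonneg (Run.mean_mem hA3 t ω)))
    (by
      refine summable_sum fun l _ => (summable_sum fun i _ => ?_).mul_left _
      refine Summable.add ?_ ((hs l i).div_const 2)
      refine ((summable_sum fun k (_ : k ∈ Finset.univ) => hαD k).mul_left (2 * L)).congr fun t => ?_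
      rw [← Finset.mul_sum]; ring)
    ⟨∑ l, (1 / (n l : ℝ)) * ∑ i, c l i, by
      refine (tendsto_finsetSum _ fun l _ => (tendsto_finsetSum _ fun i _ =>
        hc l i).const_mul (1 / (n l : ℝ))).congr fun T => ?_
      rw [Finset.sum_comm]
      refine Finset.sum_congr rfl fun l _ => ?_
      rw [← Finset.mul_sum, Finset.sum_comm]⟩
    (fun t => Run.divergence_succ_le hα hL hLip hA3 hg hz.1 t ω)
  obtain ⟨φ, hφ, hφ0⟩ := exists_subseq_tendsto_zero hα
    (fun t => hz.gap_nonneg (Run.mean_mem hA3 t ω)) hgap hα_sum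
  obtain ⟨zz, hzz, χ, hχ, hlim⟩ := (isCompact_univ_pi Γ.compact).tendsto_subseq
    (x := fun k => r.mean (φ k) ω) fun k => Run.mean_mem hA3 _ ω
  have hgap0 : Γ.gap z zz = 0 := by
    refine tendsto_nhds_unique ((Game.continuousOn_gap hz.1 zz hzz).tendsto.comp
      (tendsto_nhdsWithin_iff.2 ⟨hlim, Eventually.of_forall fun k => Run.mean_mem hA3 _ ω⟩)) ?_
    exact hφ0.comp hχ.tendsto_atTop
  obtain rfl := hz.eq_of_gap_nonpos hU hzz hgap0.le
  have hsub : Tendsto (fun k => φ (χ k)) atTop atTop := hφ.tendsto_atTop.comp hχ.tendsto_atTop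
  have hxsub : ∀ l i, Tendsto (fun k => r.x l i (φ (χ k)) ω) atTop (𝓝 (zz l)) := by
    intro l i
    have h1 : Tendsto (fun k => r.x l i (φ (χ k)) ω - r.mean (φ (χ k)) ω l) atTop (𝓝 0) :=
      squeeze_zero_norm (fun k => Run.norm_sub_mean_le _ ω l i) ((hD0 l).comp hsub)
    simpa using h1.add (tendsto_pi_nhds.1 hlim l)
  have hVsub : Tendsto (fun k => r.divergence zz (φ (χ k)) ω) atTop (𝓝 0) := by
    have : Tendsto (fun k => r.divergence zz (φ (χ k)) ω) atTop
        (𝓝 (∑ l, (1 / (n l : ℝ)) * ∑ _i : Fin (n l), 0)) :=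
      tendsto_finsetSum _ fun l _ => (tendsto_finsetSum _ fun i _ =>
        (hA3 l).reciprocity _ (hz.1 l trivial) _ (fun k => Run.mem_dom hA3 _ ω l i)
          (hxsub l i)).const_mul _
    simpa using this
  -- The full sequence of divergences converges, so its limit is the subsequential one, 0.
  obtain rfl := tendsto_nhds_unique (hv.comp hsub) hVsub
  have hn0 : (0 : ℝ) < n l := by exact_mod_cast Γ.agents_pos l
  have hle : ∀ t, ‖r.x l i t ω - zz l‖ ^ 2 ≤ 2 * n l * r.divergence zz t ω := by
    intro t
    have h1 : bregman (Γ.X l) (R l).ψ (zz l) (r.x l i t ω) ≤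
        ∑ i, bregman (Γ.X l) (R l).ψ (zz l) (r.x l i t ω) :=
      Finset.single_le_sum (f := fun i => bregman (Γ.X l) (R l).ψ (zz l) (r.x l i t ω))
        (fun i _ => hbreg0 l i t) (Finset.mem_univ i)
    have h2 : (1 / (n l : ℝ)) * ∑ i, bregman (Γ.X l) (R l).ψ (zz l) (r.x l i t ω) ≤
        r.divergence zz t ω :=
      Finset.single_le_sum
        (f := fun l => (1 / (n l : ℝ)) * ∑ i, bregman (Γ.X l) (R l).ψ (zz l) (r.x l i t ω))
        (fun l _ => mul_nonneg (by positivity) (Finset.sum_nonneg fun i _ => hbreg0 l i t))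
        (Finset.mem_univ l)
    rw [one_div, inv_mul_le_iff₀ hn0] at h2
    have h3 := hbreg l i t
    rw [norm_sub_rev] at h3
    linarith
  have hsq : Tendsto (fun t => ‖r.x l i t ω - zz l‖ ^ 2) atTop (𝓝 0) :=
    squeeze_zero (fun t => sq_nonneg _) hle (by simpa using hv.const_mul (2 * (n l : ℝ)))
  rw [tendsto_iff_norm_sub_tendsto_zero]
  simpa [Real.sqrt_sq (norm_nonneg _)] using hsq.sqrt

section Probability

variable [IsProbabilityMeasure P]

lemma Run.UnbiasedBounded.integral_sq_le {ν : Fin 2 → ℝ}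
    {g : ∀ l, Fin (n l) → ℕ → Ω → StrongDual ℝ (E l)} (h : r.UnbiasedBounded ν g) (l : Fin 2)
    (i : Fin (n l)) (t : ℕ) : ∫ ω, ‖g l i t ω - r.ghat l i t ω‖ ^ 2 ∂P ≤ ν l ^ 2 := by
  rw [← integral_condExp (r.info_le t)]
  calc _ ≤ ∫ _, ν l ^ 2 ∂P :=
        integral_mono_ae integrable_condExp (integrable_const _) (h.variance l i t)
    _ = _ := by simp

lemma Run.UnbiasedBounded.ae_summable_sq {ν : Fin 2 → ℝ}
    {g : ∀ l, Fin (n l) → ℕ → Ω → StrongDual ℝ (E l)} (h : r.UnbiasedBounded ν g) {L : ℝ}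
    (hg : r.IsCostSubgradient L g) (hα_sq : Summable fun t => α t ^ 2) (l : Fin 2)
    (i : Fin (n l)) : ∀ᵐ ω ∂P, Summable fun t => α t ^ 2 * ‖r.ghat l i t ω‖ ^ 2 := by
  have h1 : ∀ᵐ ω ∂P, Summable fun t => α t ^ 2 * ‖g l i t ω - r.ghat l i t ω‖ ^ 2 := by
    refine ae_summable_of_summable_integral (fun t ω => by positivity)
      (fun t => (h.integrable_sq l i t).const_mul _) ?_
    refine (hα_sq.mul_right (ν l ^ 2)).of_nonneg_of_le
      (fun t => integral_nonneg fun ω => by positivity) fun t => ?_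
    rw [integral_const_mul]
    exact mul_le_mul_of_nonneg_left (h.integral_sq_le l i t) (sq_nonneg _)
  filter_upwards [h1] with ω hω
  refine ((hα_sq.mul_right (2 * L ^ 2)).add (hω.mul_left 2)).of_nonneg_of_le
    (fun t => by positivity) fun t => ?_
  have h2 : ‖r.ghat l i t ω‖ ≤ L + ‖g l i t ω - r.ghat l i t ω‖ := by
    have e : r.ghat l i t ω = g l i t ω - (g l i t ω - r.ghat l i t ω) := by abel
    calc _ = ‖g l i t ω - (g l i t ω - r.ghat l i t ω)‖ := by rw [← e]
      _ ≤ _ := (norm_sub_le _ _).trans (by linarith [(hg l i t ω).2])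
  have h3 : ‖r.ghat l i t ω‖ ^ 2 ≤ 2 * L ^ 2 + 2 * ‖g l i t ω - r.ghat l i t ω‖ ^ 2 := by
    nlinarith [pow_le_pow_left₀ (norm_nonneg _) h2 2,
      sq_nonneg (L - ‖g l i t ω - r.ghat l i t ω‖)]
  nlinarith [mul_le_mul_of_nonneg_left h3 (sq_nonneg (α t))]

end Probability

variable [∀ l, FiniteDimensional ℝ (E l)] [∀ l, BorelSpace (E l)]

lemma Run.measurable_point_of {s t : ℕ}
    (h : ∀ l i, Measurable[r.info s] (r.x l i t)) (l : Fin 2) (i : Fin (n l)) (k : Fin 2) :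
    Measurable[r.info s] fun ω => r.point l i t ω k := by
  unfold Run.point estimate
  exact Finset.measurable_fun_sum _ fun j _ => (h k j).const_smul (N.W l k t i j)

/-- Adaptedness: it makes the direction z − v(t) known at time t, so that the noise has conditional
mean zero. -/
lemma Run.measurable_x (hA3 : ∀ l, (R l).Reciprocal) (t : ℕ) :
    ∀ l i, Measurable[r.info t] (r.x l i t) := by
  induction t with
  | zero =>
    intro l i
    refine Measurable.mono (comap_measurable (r.x l i 0)) ?_ le_rfl
    rw [r.info_eq]
    exact le_sup_of_le_left (le_iSup_of_le l (le_iSup_of_le i le_rfl))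
  | succ t ih =>
    intro l i
    refine Regularizer.measurable_prox (R l) (Γ.compact l)
      (Run.measurable_point_of (fun l i => (ih l i).mono (r.info_mono t.le_succ) le_rfl) l i l)
      (fun ω => Run.point_mem_dom hA3 l i t ω l) ?_ (r.step l i t)
    exact ((r.ghat_measurable l i t).const_smul (α t)).neg

lemma Run.UnbiasedBounded.ae_tendsto_noise [IsProbabilityMeasure P] {ν : Fin 2 → ℝ}
    {g : ∀ l, Fin (n l) → ℕ → Ω → StrongDual ℝ (E l)} (h : r.UnbiasedBounded ν g)
    (hA3 : ∀ l, (R l).Reciprocal) (hα_sq : Summable fun t => α t ^ 2) {z : ∀ k, E k}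
    (hz : z ∈ Set.univ.pi Γ.X) (l : Fin 2) (i : Fin (n l)) :
    ∀ᵐ ω ∂P, ∃ c, Tendsto (fun T => ∑ t ∈ Finset.range T,
      α t * (r.ghat l i t ω - g l i t ω) (z l - r.point l i t ω l)) atTop (𝓝 c) := by
  set w : ℕ → Ω → E l := fun t ω => α t • (z l - r.point l i t ω l)
  -- Centred by the conditional expectation instead of g, which is only almost surely equal to it
  -- and need not itself be measurable.
  set y : ℕ → Ω → StrongDual ℝ (E l) := fun t => r.ghat l i t - P[r.ghat l i t | r.info t]
  set ε : ℕ → Ω → ℝ := fun t ω => y t ω (w t ω)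
  set K : ℝ := Metric.diam (Γ.X l)
  have hw : ∀ t, StronglyMeasurable[r.info t] (w t) := fun t =>
    ((measurable_const.sub (Run.measurable_point_of (Run.measurable_x hA3 t) l i l)).const_smul
      (α t)).stronglyMeasurable
  have hy : ∀ t, StronglyMeasurable[r.info (t + 1)] (y t) := fun t =>
    (r.ghat_measurable l i t).sub (stronglyMeasurable_condExp.mono (r.info_mono t.le_succ))
  have hyi : ∀ t, Integrable (y t) P := fun t => (h.integrable l i t).sub integrable_condExp
  have hyg : ∀ t, ∀ᵐ ω ∂P, y t ω = r.ghat l i t ω - g l i t ω := by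
    intro t
    filter_upwards [h.unbiased l i t] with ω hω
    simp only [y, Pi.sub_apply, hω]
  have hεm : ∀ t, StronglyMeasurable[r.info (t + 1)] (ε t) := by
    intro t
    have hc : Continuous fun z : StrongDual ℝ (E l) × E l => z.1 z.2 := by fun_prop
    exact hc.comp_stronglyMeasurable ((hy t).prodMk ((hw t).mono (r.info_mono t.le_succ)))
  have hwb : ∀ t ω, ‖w t ω‖ ≤ |α t| * K := by
    intro t ω
    simp only [w]
    rw [norm_smul, Real.norm_eq_abs, ← dist_eq_norm]
    exact mul_le_mul_of_nonneg_left (Metric.dist_le_diam_of_mem (Γ.compact l).isBounded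
      (hz l trivial) (Run.point_mem hA3 l i t ω l trivial)) (abs_nonneg _)
  have hεb : ∀ t, ∀ᵐ ω ∂P, ε t ω ^ 2 ≤ α t ^ 2 * K ^ 2 * ‖g l i t ω - r.ghat l i t ω‖ ^ 2 := by
    intro t
    filter_upwards [hyg t] with ω hω
    have h1 : |ε t ω| ≤ ‖y t ω‖ * (|α t| * K) :=
      ((y t ω).le_opNorm _).trans (mul_le_mul_of_nonneg_left (hwb t ω) (norm_nonneg _))
    have h2 := pow_le_pow_left₀ (abs_nonneg _) h1 2
    rw [sq_abs, hω, norm_sub_rev, mul_pow, mul_pow, sq_abs] at h2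
    linarith
  have hεm' : ∀ t, AEStronglyMeasurable (ε t) P := fun t =>
    ((hεm t).mono (r.info_le _)).aestronglyMeasurable
  have hεi : ∀ t, Integrable (fun ω => ε t ω ^ 2) P := by
    intro t
    refine ((h.integrable_sq l i t).const_mul (α t ^ 2 * K ^ 2)).mono' ((hεm' t).pow 2) ?_
    filter_upwards [hεb t] with ω hω
    rwa [Real.norm_of_nonneg (sq_nonneg _)]
  have hε2 : ∀ t, MemLp (ε t) 2 P := fun t => (memLp_two_iff_integrable_sq (hεm' t)).2 (hεi t)
  have hyc : ∀ t, P[y t | r.info t] =ᵐ[P] 0 := by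
    intro t
    have h1 := condExp_sub (h.integrable l i t) (integrable_condExp (f := r.ghat l i t) (m := r.info t))
      (r.info t)
    rw [condExp_of_stronglyMeasurable (r.info_le t) stronglyMeasurable_condExp
      integrable_condExp] at h1
    filter_upwards [h1] with ω hω
    rw [hω, Pi.sub_apply, sub_self, Pi.zero_apply]
  have hεc : ∀ t, P[ε t | r.filtration t] =ᵐ[P] 0 := by
    intro t
    -- The direction is known at time t and is pulled out of the conditional expectation of the
    -- pairing.
    have h1 := condExp_bilin_of_stronglyMeasurable_left (ContinuousLinearMap.apply ℝ ℝ) (hw t)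
      ((hε2 t).integrable one_le_two) (hyi t)
    filter_upwards [h1, hyc t] with ω h2 h3
    refine h2.trans ?_
    rw [h3]
    simp
  have hsum : Summable fun t => ∫ ω, ε t ω ^ 2 ∂P := by
    refine (hα_sq.mul_right (K ^ 2 * ν l ^ 2)).of_nonneg_of_le
      (fun t => integral_nonneg fun ω => sq_nonneg _) fun t => ?_
    calc ∫ ω, ε t ω ^ 2 ∂P ≤ ∫ ω, α t ^ 2 * K ^ 2 * ‖g l i t ω - r.ghat l i t ω‖ ^ 2 ∂P :=
          integral_mono_ae (hεi t) ((h.integrable_sq l i t).const_mul _) (hεb t)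
      _ ≤ α t ^ 2 * K ^ 2 * ν l ^ 2 := by
          rw [integral_const_mul]
          exact mul_le_mul_of_nonneg_left (h.integral_sq_le l i t) (by positivity)
      _ = _ := by ring
  have hlim := ae_tendsto_sum_of_martingale_difference (ℱ := r.filtration) hεm hε2 hεc hsum
  filter_upwards [hlim, ae_all_iff.2 hyg] with ω ⟨c, hω⟩ hω2
  refine ⟨c, hω.congr fun T => Finset.sum_congr rfl fun t _ => ?_⟩
  simp only [ε, hω2, w, map_smul, smul_eq_mul]

end Stochastic

end DSMD

end

/-! ### The convergence theorem. -/

open MeasureTheory ProbabilityTheory Filter Topology in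
theorem theorem5 {Ω : Type*} [MeasurableSpace Ω] (P : Measure Ω) [IsProbabilityMeasure P]
    {E : Fin 2 → Type*} [∀ l, NormedAddCommGroup (E l)] [∀ l, NormedSpace ℝ (E l)]
    [∀ l, FiniteDimensional ℝ (E l)] [∀ l, MeasurableSpace (E l)] [∀ l, BorelSpace (E l)]
    {n : Fin 2 → ℕ} {d : ℕ}
    (Γ : DSMD.Game E P n d) (N : DSMD.Network n) (R : ∀ l, DSMD.Regularizer (Γ.X l))
    (α : ℕ → ℝ) (hα_nonneg : ∀ t, 0 ≤ α t) (hα_anti : Antitone α)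
    (r : DSMD.Run Γ N R α)
    (hU : Γ.StrictConvexConcave)
    (L : ℝ) (hL : 0 < L) (hLip : Γ.LipschitzCosts L)
    (g : ∀ l, Fin (n l) → ℕ → Ω → StrongDual ℝ (E l)) (hg : r.IsCostSubgradient L g)
    (ν : Fin 2 → ℝ) (hν : ∀ l, 0 < ν l) (hA2 : r.UnbiasedBounded ν g)
    (hA3 : ∀ l, (R l).Reciprocal)
    (hα_sum : Tendsto (fun T => ∑ t ∈ Finset.Icc 1 T, α t) atTop atTop)
    (hα_sq : Summable (fun t => α t ^ 2)) :
    ∃ xs : ∀ l, E l, Γ.IsNash xs ∧ (∀ y, Γ.IsNash y → y = xs) ∧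
      ∀ᵐ ω ∂P, ∀ l i, Tendsto (fun t => r.x l i t ω) atTop (𝓝 (xs l)) := by
  obtain ⟨xs, hxs⟩ := hU.exists_isNash
  have hns : ¬ Summable α := fun hs => by
    have h1 : ∀ T, ∑ t ∈ Finset.Icc 1 T, α t ≤ ∑' t, α t := fun T =>
      hs.sum_le_tsum _ fun t _ => hα_nonneg t
    obtain ⟨T, hT⟩ := (hα_sum.eventually_gt_atTop (∑' t, α t)).exists
    exact (hT.trans_le (h1 T)).false
  refine ⟨xs, hxs, fun y hy => hxs.unique hU hy, ?_⟩
  have h1 : ∀ᵐ ω ∂P, ∀ l i, Summable fun t => α t ^ 2 * ‖r.ghat l i t ω‖ ^ 2 :=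
    ae_all_iff.2 fun l => ae_all_iff.2 fun i => hA2.ae_summable_sq hg hα_sq l i
  have h2 : ∀ᵐ ω ∂P, ∀ l i, ∃ c, Tendsto (fun T => ∑ t ∈ Finset.range T,
      α t * (r.ghat l i t ω - g l i t ω) (xs l - r.point l i t ω l)) atTop (𝓝 c) :=
    ae_all_iff.2 fun l => ae_all_iff.2 fun i => hA2.ae_tendsto_noise hA3 hα_sq hxs.1 l i
  filter_upwards [h1, h2] with ω hω1 hω2
  exact fun l i => DSMD.Run.tendsto_of_summable hα_nonneg hα_sq hns hU hL.le hLip hA3 hg hxs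
    hω1 hω2 l i
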